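/- **Setting.** A *monadic Markov logic network* (MLN) $\Delta$ over $N$ unary predicates $P_1,\dots,P_N$ is a finite collection of pairs $(w,f)$, where $w\in\mathbb{R}$ and $f$ is a function-free and constant-free first-order formula all of whose atoms have the form $P_j(\mathsf{x})$ with a logical variable $\mathsf x$. Given a domain $\mathbf{D}=\{1,\dots,n\}$, the random variables are the $Nn$ binary ground atoms $P_j(i)$, and a world $\mathbf{x}$ is an assignment of truth values to all of them. The groundings of $f$ are obtained by instantiating its free variables with elements of $\mathbf D$ in all possible ways. The weight of $\mathbf{x}$ is the product of $\exp(w)$ over all $(w,f)\in\Delta$ and all groundings of $f$ that $\mathbf{x}$ satisfies, and $\Pr(\mathbf{x})$ is this weight divided by the sum $Z$ of the weights of all worlds. For a partial assignment $\mathbf{e}$ to the ground atoms, $\Pr(\mathbf{e})$ is the sum of $\Pr(\mathbf{x})$ over the worlds $\mathbf{x}$ that agree with $\mathbf{e}$. *MPE inference* is the task of finding, given $\Delta$, $\mathbf D$ and $\mathbf{e}$, an assignment $\mathbf{y}\in\arg\max_{\mathbf{y}}\Pr(\mathbf{y},\mathbf{e})$ to the ground atoms that $\mathbf{e}$ leaves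 unassigned (reported together with $\mathbf e$ as a full world). *Marginal inference* is the task of computing $\Pr(\mathbf{e})$. Algorithms are first-order recursive functional programs over list structures (S-expressions) whose atoms are real numbers, with exact arithmetic $+,-,\times,\div$ and comparison $<$ of reals, pairing and projections each at unit cost, and with natural numbers as the only program constants; running time is the number of evaluation steps. The input consists of $N$, of $\Delta$ (each formula $f$ as a syntax tree with indices in unary, each weight $w$ through the real number $\exp(w)$), and of $\mathbf{e}$ as an $n\times N$ table with entries in $\{0,1,*\}$, where $*$ stands for "unassigned". **Corollary.** MPE inference and marginal inference in monadic MLNs are domain-lifted, i.e. polynomial in the domain size: for each of the two tasks there is a single algorithm that, for every $N$, every monadic MLN $\Delta$ over $N$ unary predicates, every finite domain $\mathbf{D}$ and every partial assignment $\mathbf{e}$ to the ground atoms, halts with a correct answer, and for every fixed $\Delta$ there is a polynomial $q_\Delta$ such that its running time is at most $q_\Delta(|\mathbf{D}|)$ for all $\mathbf{D}$ and all $\mathbf{e}$. -/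

import Mathlib

namespace MLN

/-! ### Monadic Markov logic networks -/

/-- Function-free and constant-free first-order formulas over the unary predicates
`P_0, …, P_{N-1}`, with logical variables indexed by `ℕ`. -/
inductive Formula (N : ℕ) : Type where
  /-- the atom `P_p(x_v)` -/
  | atom (p : Fin N) (v : ℕ) : Formula N
  | neg (f : Formula N) : Formula N
  | and (f g : Formula N) : Formula N
  /-- `∀ x_v, f` -/
  | all (v : ℕ) (f : Formula N) : Formula N

namespace Formula

/-- The remaining connectives and the existential quantifier are the usual abbreviations. -/
def or {N : ℕ} (f g : Formula N) : Formula N := neg (and (neg f) (neg g))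

def imp {N : ℕ} (f g : Formula N) : Formula N := neg (and f (neg g))

def iff {N : ℕ} (f g : Formula N) : Formula N := and (imp f g) (imp g f)

def ex {N : ℕ} (v : ℕ) (f : Formula N) : Formula N := neg (all v (neg f))

/-- The set of logical variables with a free occurrence. -/
def freeVars {N : ℕ} : Formula N → Finset ℕ
  | atom _ v => {v}
  | neg f => f.freeVars
  | and f g => f.freeVars ∪ g.freeVars
  | all v f => f.freeVars.erase v

end Formula

/-- A monadic MLN: finitely many weighted formulas `(w, f)` over `N` unary predicates. -/
abbrev Network (N : ℕ) : Type := List (ℝ × Formula N)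

/-- A possible world over the domain `Fin n`: a truth value for each ground atom `P_p(d)`,
the random variable `P_p(d)` being indexed by `p` and `d`. -/
abbrev World (N n : ℕ) : Type := Fin N → Fin n → Bool

/-- A partial assignment `e` to the ground atoms (`none` means not assigned). -/
abbrev Evidence (N n : ℕ) : Type := Fin N → Fin n → Option Bool

/-- Truth of `f` in the world `x`, when the logical variables are instantiated according to `g`.
(`g` is partial, so that the empty domain needs no exception; an atom with an uninstantiated
variable counts as false, which does not occur for the groundings below.) -/
def holds {N n : ℕ} (x : World N n) : Formula N → (ℕ → Option (Fin n)) → Bool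
  | .atom p v, g => (g v).elim false (x p)
  | .neg f, g => !(holds x f g)
  | .and f₁ f₂, g => holds x f₁ g && holds x f₂ g
  | .all v f, g => decide (∀ d : Fin n, holds x f (Function.update g v (some d)) = true)

/-- A grounding of `f` instantiates each of its free variables with a constant of the domain. -/
abbrev Grounding {N : ℕ} (f : Formula N) (n : ℕ) : Type := {v : ℕ // v ∈ f.freeVars} → Fin n

def Grounding.toPartial {N n : ℕ} {f : Formula N} (g : Grounding f n) : ℕ → Option (Fin n) :=
  fun v => if h : v ∈ f.freeVars then some (g ⟨v, h⟩) else none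

/-- The weight of a world: the product of `exp w` over all ground formulas satisfied by it. -/
noncomputable def weight {N n : ℕ} (Δ : Network N) (x : World N n) : ℝ :=
  (Δ.map fun wf => ∏ g : Grounding wf.2 n,
    if holds x wf.2 g.toPartial = true then Real.exp wf.1 else 1).prod

/-- The normalizing constant `Z`. -/
noncomputable def partitionFunction {N : ℕ} (Δ : Network N) (n : ℕ) : ℝ :=
  ∑ x : World N n, weight Δ x

/-- The probability of a world. -/
noncomputable def prob {N n : ℕ} (Δ : Network N) (x : World N n) : ℝ :=
  weight Δ x / partitionFunction Δ n

/-- `x ∼ e`: the full assignment `x` agrees with `e` on the variables assigned by `e`. -/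
def Agrees {N n : ℕ} (x : World N n) (e : Evidence N n) : Prop :=
  ∀ p d b, e p d = some b → x p d = b

open Classical in
/-- `Pr(e)`, the total probability of the worlds that agree with `e`. -/
noncomputable def marginal {N n : ℕ} (Δ : Network N) (e : Evidence N n) : ℝ :=
  ∑ x : World N n with Agrees x e, prob Δ x

/-- `x = (y, e)` where `y`, an assignment to the variables that `e` leaves open,
maximizes `Pr(y, e)`. -/
def IsMPE {N n : ℕ} (Δ : Network N) (e : Evidence N n) (x : World N n) : Prop :=
  Agrees x e ∧ ∀ x' : World N n, Agrees x' e → prob Δ x' ≤ prob Δ x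

/-! ### The machine model

First-order recursive functional programs over S-expressions whose atoms are real numbers, with
exact real arithmetic at unit cost (a real-number machine in the sense of Blum, Shub and Smale,
with list memory instead of a tape). The only numerical constants of a program are natural
numbers, so no information can be hidden in a program constant. Each evaluation step takes boundedly
many operations on a real RAM that represents pairs by pointers. -/

/-- S-expressions with real atoms. -/
inductive Val : Type where
  | nil : Val
  | num (r : ℝ) : Val
  | cons (a b : Val) : Val

namespace Val

def head : Val → Val
  | cons a _ => a
  | _ => nil

def tail : Val → Val
  | cons _ b => b
  | _ => nil

def IsCons : Val → Prop
  | cons _ _ => True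
  | _ => False

def toReal : Val → ℝ
  | num r => r
  | _ => 0

end Val

/-- The arithmetic operations. -/
inductive Op : Type where
  | add | sub | mul | div

noncomputable def Op.apply : Op → ℝ → ℝ → ℝ
  | add, a, b => a + b
  | sub, a, b => a - b
  | mul, a, b => a * b
  | div, a, b => a / b

/-- Expressions; variables are de Bruijn indices into the environment. -/
inductive Expr : Type where
  | var (i : ℕ) : Expr
  | nil : Expr
  | nat (k : ℕ) : Expr
  | cons (a b : Expr) : Expr
  | head (a : Expr) : Expr
  | tail (a : Expr) : Expr
  | arith (o : Op) (a b : Expr) : Expr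
  /-- evaluate `s` if `c` evaluates to a pair, and `t` otherwise -/
  | ifCons (c s t : Expr) : Expr
  /-- evaluate `s` if `a < b`, and `t` otherwise -/
  | ifLt (a b s t : Expr) : Expr
  /-- `let` binding of the value of `a` as variable `0` in `b` -/
  | bind (a b : Expr) : Expr
  /-- call of function number `k` of the program, which may be recursive -/
  | call (k : ℕ) (a : Expr) : Expr

/-- A program: the list of the bodies of its functions, each of one argument (variable `0`).
Function number `0` is the main function. -/
abbrev Program : Type := List Expr

/-- `Eval P ρ a v t`: in the environment `ρ`, the expression `a` evaluates to `v` in exactly `t`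
steps (call-by-value, one step for each expression node that is visited). -/
inductive Eval (P : Program) : List Val → Expr → Val → ℕ → Prop where
  | var {ρ : List Val} {i : ℕ} {v : Val} (h : ρ[i]? = some v) : Eval P ρ (.var i) v 1
  | nil {ρ : List Val} : Eval P ρ .nil .nil 1
  | nat {ρ : List Val} {k : ℕ} : Eval P ρ (.nat k) (.num k) 1
  | cons {ρ : List Val} {a b : Expr} {u v : Val} {s t : ℕ}
      (ha : Eval P ρ a u s) (hb : Eval P ρ b v t) :
      Eval P ρ (.cons a b) (.cons u v) (s + t + 1)
  | head {ρ : List Val} {a : Expr} {v : Val} {t : ℕ} (ha : Eval P ρ a v t) :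
      Eval P ρ (.head a) v.head (t + 1)
  | tail {ρ : List Val} {a : Expr} {v : Val} {t : ℕ} (ha : Eval P ρ a v t) :
      Eval P ρ (.tail a) v.tail (t + 1)
  | arith {ρ : List Val} {o : Op} {a b : Expr} {u v : Val} {s t : ℕ}
      (ha : Eval P ρ a u s) (hb : Eval P ρ b v t) :
      Eval P ρ (.arith o a b) (.num (o.apply u.toReal v.toReal)) (s + t + 1)
  | ifConsPos {ρ : List Val} {c a b : Expr} {u v : Val} {s t : ℕ}
      (hc : Eval P ρ c u s) (h : u.IsCons) (ha : Eval P ρ a v t) :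
      Eval P ρ (.ifCons c a b) v (s + t + 1)
  | ifConsNeg {ρ : List Val} {c a b : Expr} {u v : Val} {s t : ℕ}
      (hc : Eval P ρ c u s) (h : ¬ u.IsCons) (hb : Eval P ρ b v t) :
      Eval P ρ (.ifCons c a b) v (s + t + 1)
  | ifLtPos {ρ : List Val} {c d a b : Expr} {u u' v : Val} {s s' t : ℕ}
      (hc : Eval P ρ c u s) (hd : Eval P ρ d u' s') (h : u.toReal < u'.toReal)
      (ha : Eval P ρ a v t) :
      Eval P ρ (.ifLt c d a b) v (s + s' + t + 1)
  | ifLtNeg {ρ : List Val} {c d a b : Expr} {u u' v : Val} {s s' t : ℕ}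
      (hc : Eval P ρ c u s) (hd : Eval P ρ d u' s') (h : ¬ u.toReal < u'.toReal)
      (hb : Eval P ρ b v t) :
      Eval P ρ (.ifLt c d a b) v (s + s' + t + 1)
  | bind {ρ : List Val} {a b : Expr} {u v : Val} {s t : ℕ}
      (ha : Eval P ρ a u s) (hb : Eval P (u :: ρ) b v t) :
      Eval P ρ (.bind a b) v (s + t + 1)
  | call {ρ : List Val} {k : ℕ} {a body : Expr} {u v : Val} {s t : ℕ}
      (ha : Eval P ρ a u s) (hk : P[k]? = some body) (hb : Eval P [u] body v t) :
      Eval P ρ (.call k a) v (s + t + 1)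

/-- Started on `input`, the program halts with the result `output` after exactly `t` steps. -/
def Program.Runs (P : Program) (input output : Val) (t : ℕ) : Prop :=
  Eval P [input] (.call 0 (.var 0)) output t

/-! ### Input and output formats -/

namespace Val

def ofList : List Val → Val
  | [] => nil
  | a :: l => cons a (ofList l)

/-- Natural numbers (indices of predicates and variables, tags) are written in unary. -/
def ofNat (k : ℕ) : Val := ofList (List.replicate k nil)

def ofOptionBool : Option Bool → Val
  | none => ofNat 0
  | some false => ofNat 1
  | some true => ofNat 2

def ofFormula {N : ℕ} : Formula N → Val
  | .atom p v => cons (ofNat 0) (cons (ofNat p) (ofNat v))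
  | .neg f => cons (ofNat 1) (ofFormula f)
  | .and f g => cons (ofNat 2) (cons (ofFormula f) (ofFormula g))
  | .all v f => cons (ofNat 3) (cons (ofNat v) (ofFormula f))

/-- A weighted formula `(w, f)` is given by the factor `exp w`, a real atom, and by `f`. -/
noncomputable def ofNetwork {N : ℕ} (Δ : Network N) : Val :=
  ofList (Δ.map fun wf => cons (num (Real.exp wf.1)) (ofFormula wf.2))

/-- A partial assignment is given as a table with one row for each element of the domain and,
within each row, one entry for each predicate. -/
def ofEvidence {N n : ℕ} (e : Evidence N n) : Val :=
  ofList (List.ofFn fun d => ofList (List.ofFn fun p => ofOptionBool (e p d)))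

def ofWorld {N n : ℕ} (x : World N n) : Val := ofEvidence fun p d => some (x p d)

/-- The input of an inference algorithm: the number of predicates, the network and the evidence,
whose table has as many rows as the domain has elements. -/
noncomputable def ofInstance {N n : ℕ} (Δ : Network N) (e : Evidence N n) : Val :=
  cons (ofNat N) (cons (ofNetwork Δ) (ofEvidence e))

end Val

/-! ### Domain-lifted inference -/

/-- An inference task says which outputs are correct for a given network and evidence. -/
abbrev Task : Type := ∀ N n : ℕ, Network N → Evidence N n → Val → Prop

def MPETask : Task := fun _ _ Δ e v => ∃ x, IsMPE Δ e x ∧ v = Val.ofWorld x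

def MarginalTask : Task := fun _ _ Δ e v => v = Val.num (marginal Δ e)

/-- One algorithm solves the task for all monadic MLNs, all finite domains and all evidence, and
for each fixed MLN its running time is polynomial in the size `n` of the domain. -/
def DomainLifted (T : Task) : Prop :=
  ∃ P : Program, ∀ (N : ℕ) (Δ : Network N), ∃ q : Polynomial ℕ, ∀ (n : ℕ) (e : Evidence N n),
    ∃ (v : Val) (t : ℕ), P.Runs (Val.ofInstance Δ e) v t ∧ t ≤ q.eval n ∧ T N n Δ e v

end MLN

/-! Call the truth values of all `N` predicates at one domain element its row. Since formulas
contain no constants and all atoms are unary, an element enters the truth of a formula only through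
its row, and quantifiers and groundings range over all rows alike. Hence the weight of a world
depends only on the multiset of its rows (`holds_eq_holdsRows`, `weight_eq_weightRows`,
`weightRows_perm`). For fixed `N` there are only polynomially many multisets of `n` rows.

Both algorithms list the multisets that occur among the worlds agreeing with `e`, each with one
representative and the number of worlds in its class. The list is built by dynamic programming over
the rows of evidence: every item is extended by every completion of the next row, and items with
equal multisets are merged. Multisets are recognized by the number `∑ B ^ code(row)` with `B = n +
1`. Its base-`B` digits are the multiplicities, which are at most `n`, so it determines the multiset
(`perm_of_worldKey_eq`). As these keys are distinct naturals of size at most `n * (n + 1) ^ 2 ^ N`,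
their size also bounds the length of the list; large keys cost nothing extra in exact unit-cost
arithmetic.

The invariant is `itemSum_items`: for every permutation-invariant `F`, the sum of `F` over the
items, weighted by their counts, is its sum over all agreeing worlds. For the weight this gives the
numerator of `Pr(e)`, and with blank evidence it gives `Z`. For the indicator of a class it shows
that no class is missed, so a representative of maximal weight is an MPE solution. A single weight
is computed by looping over the rows for each quantifier and each free variable, which is polynomial
in `n` for a fixed network. -/

namespace MLN

/-! ### A weakest precondition calculus for programs -/

/-- Function `k` of the program `P` maps `u` to `v` in at most `T` steps. -/
def Computes (P : Program) (k : ℕ) (u v : Val) (T : ℕ) : Prop :=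
  ∃ body t, P[k]? = some body ∧ Eval P [u] body v t ∧ t ≤ T

/-- The weakest precondition for `a` to have a value and a time bound that satisfy `Q`. -/
def wp (P : Program) : List Val → Expr → (Val → ℕ → Prop) → Prop
  | ρ, .var i, Q => match ρ[i]? with
    | some v => Q v 1
    | none => False
  | _, .nil, Q => Q .nil 1
  | _, .nat k, Q => Q (.num k) 1
  | ρ, .cons a b, Q => wp P ρ a fun u s => wp P ρ b fun v t => Q (.cons u v) (s + t + 1)
  | ρ, .head a, Q => wp P ρ a fun v t => Q v.head (t + 1)
  | ρ, .tail a, Q => wp P ρ a fun v t => Q v.tail (t + 1)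
  | ρ, .arith o a b, Q => wp P ρ a fun u s => wp P ρ b fun v t =>
      Q (.num (o.apply u.toReal v.toReal)) (s + t + 1)
  | ρ, .ifCons c a b, Q => wp P ρ c fun u s =>
      (u.IsCons → wp P ρ a fun v t => Q v (s + t + 1)) ∧
      (¬ u.IsCons → wp P ρ b fun v t => Q v (s + t + 1))
  | ρ, .ifLt c d a b, Q => wp P ρ c fun u s => wp P ρ d fun u' s' =>
      (u.toReal < u'.toReal → wp P ρ a fun v t => Q v (s + s' + t + 1)) ∧
      (¬ u.toReal < u'.toReal → wp P ρ b fun v t => Q v (s + s' + t + 1))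
  | ρ, .bind a b, Q => wp P ρ a fun u s => wp P (u :: ρ) b fun v t => Q v (s + t + 1)
  | ρ, .call k a, Q => wp P ρ a fun u s => ∃ v t, Computes P k u v t ∧ Q v (s + t + 1)

/-- The calculus propagates upper bounds instead of exact times: a call may contribute any bound
granted by `Computes`. As `Q` is evaluated at the bound itself, it need not be monotone. Calls are
not unfolded, so recursive functions are verified by induction on their data. -/
theorem wp_sound {P : Program} (a : Expr) : ∀ {ρ : List Val} {Q : Val → ℕ → Prop}, wp P ρ a Q →
    ∃ v t T, Eval P ρ a v t ∧ t ≤ T ∧ Q v T := by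
  induction a with
  | var i =>
    intro ρ Q h
    simp only [wp] at h
    split at h
    · exact ⟨_, _, _, .var ‹_›, le_rfl, h⟩
    · exact h.elim
  | nil => exact fun h => ⟨_, _, _, .nil, le_rfl, h⟩
  | nat k => exact fun h => ⟨_, _, _, .nat, le_rfl, h⟩
  | cons a b iha ihb =>
    intro ρ Q h
    obtain ⟨u, s, S, h1, h2, h3⟩ := iha h
    obtain ⟨v, t, T, h4, h5, h6⟩ := ihb h3
    exact ⟨_, _, _, .cons h1 h4, by omega, h6⟩
  | head a iha =>
    intro ρ Q h
    obtain ⟨u, s, S, h1, h2, h3⟩ := iha h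
    exact ⟨_, _, _, .head h1, by omega, h3⟩
  | tail a iha =>
    intro ρ Q h
    obtain ⟨u, s, S, h1, h2, h3⟩ := iha h
    exact ⟨_, _, _, .tail h1, by omega, h3⟩
  | arith o a b iha ihb =>
    intro ρ Q h
    obtain ⟨u, s, S, h1, h2, h3⟩ := iha h
    obtain ⟨v, t, T, h4, h5, h6⟩ := ihb h3
    exact ⟨_, _, _, .arith h1 h4, by omega, h6⟩
  | ifCons c a b ihc iha ihb =>
    intro ρ Q h
    obtain ⟨u, s, S, h1, h2, h3, h3'⟩ := ihc h
    by_cases hu : u.IsCons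
    · obtain ⟨v, t, T, h4, h5, h6⟩ := iha (h3 hu)
      exact ⟨_, _, _, .ifConsPos h1 hu h4, by omega, h6⟩
    · obtain ⟨v, t, T, h4, h5, h6⟩ := ihb (h3' hu)
      exact ⟨_, _, _, .ifConsNeg h1 hu h4, by omega, h6⟩
  | ifLt c d a b ihc ihd iha ihb =>
    intro ρ Q h
    obtain ⟨u, s, S, h1, h2, h3⟩ := ihc h
    obtain ⟨u', s', S', k1, k2, k3, k3'⟩ := ihd h3
    by_cases hu : u.toReal < u'.toReal
    · obtain ⟨v, t, T, h4, h5, h6⟩ := iha (k3 hu)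
      exact ⟨_, _, _, .ifLtPos h1 k1 hu h4, by omega, h6⟩
    · obtain ⟨v, t, T, h4, h5, h6⟩ := ihb (k3' hu)
      exact ⟨_, _, _, .ifLtNeg h1 k1 hu h4, by omega, h6⟩
  | bind a b iha ihb =>
    intro ρ Q h
    obtain ⟨u, s, S, h1, h2, h3⟩ := iha h
    obtain ⟨v, t, T, h4, h5, h6⟩ := ihb h3
    exact ⟨_, _, _, .bind h1 h4, by omega, h6⟩
  | call k a iha =>
    intro ρ Q h
    obtain ⟨u, s, S, h1, h2, v, T, ⟨b, t, h3, h4, h5⟩, h6⟩ := iha h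
    exact ⟨_, _, _, .call h1 h3 h4, by omega, h6⟩

theorem Computes.of_wp {P : Program} {k : ℕ} {u v : Val} {T : ℕ} {body : Expr}
    (hk : P[k]? = some body) (h : wp P [u] body fun v' t => v' = v ∧ t ≤ T) :
    Computes P k u v T := by
  obtain ⟨_, t, T', h1, h2, rfl, h3⟩ := wp_sound body h
  exact ⟨body, t, hk, h1, h2.trans h3⟩

theorem Computes.runs {P : Program} {u v : Val} {T : ℕ} (h : Computes P 0 u v T) :
    ∃ t, P.Runs u v t ∧ t ≤ T + 2 := by
  obtain ⟨b, t, h1, h2, h3⟩ := h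
  exact ⟨_, .call (.var rfl) h1 h2, by omega⟩

/-! ### The program -/

namespace Expr

abbrev arg : Expr := .var 0

/-- The truth value `true`. -/
abbrev tt : Expr := .cons .nil .nil

/-- `(i, l) ↦` entry number `i` of `l` -/
def nthBody : Expr :=
  .ifCons arg.head (.call 1 (.cons arg.head.tail arg.tail.tail)) arg.tail.head

/-- `(i, x, l) ↦` the list `l` with `x` as entry number `i` -/
def setBody : Expr :=
  .ifCons arg.head
    (.cons arg.tail.tail.head
      (.call 2 (.cons arg.head.tail (.cons arg.tail.head arg.tail.tail.tail))))
    (.cons arg.tail.head arg.tail.tail.tail)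

/-- union of two sets of natural numbers, given by lists of marks -/
def orBody : Expr :=
  .ifCons arg.head
    (.cons (.ifCons arg.head.head arg.head.head arg.tail.head)
      (.call 3 (.cons arg.head.tail arg.tail.tail)))
    arg.tail

/-- the list of marks of the free variables of a formula -/
def fvBody : Expr :=
  -- Tags are unary numerals, so tests on successive tails separate the four constructors, with the
  -- quantifier innermost.
  .ifCons arg.head
    (.ifCons arg.head.tail
      (.ifCons arg.head.tail.tail
        (.call 2 (.cons arg.tail.head (.cons .nil (.call 4 arg.tail.tail))))
        (.call 3 (.cons (.call 4 arg.tail.head) (.call 4 arg.tail.tail))))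
      (.call 4 arg.tail))
    (.call 2 (.cons arg.tail.tail (.cons tt .nil)))

/-- `(f, env, world) ↦` truth value of the formula `f` -/
def evBody : Expr :=
  .ifCons arg.head.head
    (.ifCons arg.head.head.tail
      (.ifCons arg.head.head.tail.tail
        (.call 6 (.cons arg.tail.tail (.cons arg.head.tail arg.tail)))
        (.ifCons (.call 5 (.cons arg.head.tail.head arg.tail))
          (.call 5 (.cons arg.head.tail.tail arg.tail)) .nil))
      (.ifCons (.call 5 (.cons arg.head.tail arg.tail)) .nil tt))
    (.ifCons (.tail (.call 1 (.cons arg.head.tail.head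
      (.call 1 (.cons arg.head.tail.tail arg.tail.head))))) tt .nil)

/-- `(rows, (v, f), env, world) ↦` whether `f` is true for all values of `v` among the rows -/
def evAllBody : Expr :=
  .ifCons arg.head
    (.ifCons (.call 5 (.cons arg.tail.head.tail (.cons (.call 2 (.cons arg.tail.head.head
        (.cons arg.head.head arg.tail.tail.head))) arg.tail.tail.tail)))
      (.call 6 (.cons arg.head.tail arg.tail)) .nil)
    tt

/-- `(marks, i, env, world, w, f) ↦` product of the factors of the groundings of `f` -/
def grBody : Expr :=
  .ifCons arg.head
    (.ifCons arg.head.head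
      (.call 8 (.cons arg.tail.tail.tail.head (.cons arg.head.tail arg.tail)))
      (.call 7 (.cons arg.head.tail (.cons (.cons .nil arg.tail.head) arg.tail.tail))))
    (.ifCons (.call 5 (.cons arg.tail.tail.tail.tail.tail
        (.cons arg.tail.tail.head arg.tail.tail.tail.head)))
      arg.tail.tail.tail.tail.head (.nat 1))

/-- `(rows, marks, i, env, world, w, f) ↦` the same product, with the value of variable `i`
restricted to the rows -/
def grAllBody : Expr :=
  .ifCons arg.head
    (.arith .mul
      (.call 7 (.cons arg.tail.head (.cons (.cons .nil arg.tail.tail.head)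
        (.cons (.call 2 (.cons arg.tail.tail.head (.cons arg.head.head arg.tail.tail.tail.head)))
          arg.tail.tail.tail.tail))))
      (.call 8 (.cons arg.head.tail arg.tail)))
    (.nat 1)

/-- `(network, world) ↦` weight -/
def wtBody : Expr :=
  .ifCons arg.head
    (.arith .mul
      (.call 7 (.cons (.call 4 arg.head.head.tail) (.cons .nil (.cons .nil
        (.cons arg.tail arg.head.head)))))
      (.call 9 (.cons arg.head.tail arg.tail)))
    (.nat 1)

/-- the list of the completions of a row of evidence -/
def compBody : Expr :=
  .ifCons arg
    (.bind (.call 10 arg.tail)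
      (.ifCons (Expr.var 1).head
        (.call 11 (.cons (Expr.var 1).head (.cons (.var 0) .nil)))
        -- As a table entry, `tt` is the unary numeral 1, which stands for false; `.cons .nil tt` is
        -- 2, which stands for true.
        (.call 11 (.cons tt (.cons (.var 0)
          (.call 11 (.cons (.cons .nil tt) (.cons (.var 0) .nil))))))))
    (.cons .nil .nil)

/-- `(a, l, acc) ↦` the list of all `a :: c` with `c` in `l`, followed by `acc` -/
def mapConsBody : Expr :=
  .ifCons arg.tail.head
    (.cons (.cons arg.head arg.tail.head.head)
      (.call 11 (.cons arg.head (.cons arg.tail.head.tail arg.tail.tail))))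
    arg.tail.tail

/-- `(B, row) ↦ B ^ c` with `c` the binary code of the row -/
def rowKeyBody : Expr :=
  .ifCons arg.tail
    (.bind (.call 12 (.cons arg.head arg.tail.tail))
      (.arith .mul (.arith .mul (.var 0) (.var 0))
        (.ifCons (Expr.var 1).tail.head.tail (Expr.var 1).head (.nat 1))))
    (.nat 1)

/-- `(item, l) ↦` the list of items `l` with an item merged into it -/
def insBody : Expr :=
  .ifCons arg.tail
    -- Equality of keys is recognized by the failure of both strict inequalities.
    (.ifLt arg.head.head arg.tail.head.head
      (.cons arg.tail.head (.call 13 (.cons arg.head arg.tail.tail)))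
      (.ifLt arg.tail.head.head arg.head.head
        (.cons arg.tail.head (.call 13 (.cons arg.head arg.tail.tail)))
        (.cons (.cons arg.tail.head.head (.cons arg.tail.head.tail.head
          (.arith .add arg.tail.head.tail.tail arg.head.tail.tail))) arg.tail.tail)))
    (.cons arg.head .nil)

/-- `(rows, item, B, acc) ↦ acc` with all extensions of the item by one of the rows -/
def extendBody : Expr :=
  .ifCons arg.head
    (.call 14 (.cons arg.head.tail (.cons arg.tail.head (.cons arg.tail.tail.head
      (.call 13 (.cons
        (.cons (.arith .add arg.tail.head.head (.call 12 (.cons arg.tail.tail.head arg.head.head)))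
          (.cons (.cons arg.head.head arg.tail.head.tail.head) arg.tail.head.tail.tail))
        arg.tail.tail.tail))))))
    arg.tail.tail.tail

/-- `(items, rows, B, acc) ↦ acc` with all extensions of the items by one of the rows -/
def extendAllBody : Expr :=
  .ifCons arg.head
    (.call 15 (.cons arg.head.tail (.cons arg.tail.head (.cons arg.tail.tail.head
      (.call 14 (.cons arg.tail.head (.cons arg.head.head arg.tail.tail)))))))
    arg.tail.tail.tail

/-- `(table, B) ↦` the list of items -/
def itemsBody : Expr :=
  .ifCons arg.head
    (.call 15 (.cons (.call 16 (.cons arg.head.tail arg.tail))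
      (.cons (.call 10 arg.head.head) (.cons arg.tail .nil))))
    (.cons (.cons (.nat 0) (.cons .nil (.nat 1))) .nil)

/-- length plus one -/
def lengthBody : Expr :=
  .ifCons arg (.arith .add (.call 17 arg.tail) (.nat 1)) (.nat 1)

/-- `(table, row) ↦` the table with all rows replaced by `row` -/
def blankBody : Expr :=
  .ifCons arg.head (.cons arg.tail (.call 18 (.cons arg.head.tail arg.tail))) .nil

/-- `(items, network) ↦` total weight -/
def totalBody : Expr :=
  .ifCons arg.head
    (.arith .add
      (.arith .mul arg.head.head.tail.tail (.call 9 (.cons arg.tail arg.head.head.tail.head)))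
      (.call 19 (.cons arg.head.tail arg.tail)))
    (.nat 0)

/-- `(items, network, world, weight) ↦` a world of maximal weight -/
def bestBody : Expr :=
  .ifCons arg.head
    (.bind (.call 9 (.cons arg.tail.head arg.head.head.tail.head))
      (.ifLt (Expr.var 1).tail.tail.tail (.var 0)
        (.call 20 (.cons (Expr.var 1).head.tail (.cons (Expr.var 1).tail.head
          (.cons (Expr.var 1).head.head.tail.head (.var 0)))))
        (.call 20 (.cons (Expr.var 1).head.tail (Expr.var 1).tail))))
    arg.tail.tail.head

/-- MPE inference -/
def mpeBody : Expr :=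
  .call 20 (.cons (.call 16 (.cons arg.tail.tail (.call 17 arg.tail.tail)))
    (.cons arg.tail.head (.cons .nil (.nat 0))))

/-- marginal inference -/
def marginalBody : Expr :=
  .bind (.call 17 arg.tail.tail)
    (.arith .div
      (.call 19 (.cons (.call 16 (.cons (Expr.var 1).tail.tail (.var 0))) (Expr.var 1).tail.head))
      (.call 19 (.cons (.call 16 (.cons
        (.call 18 (.cons (Expr.var 1).tail.tail (Expr.var 1).head)) (.var 0)))
        (Expr.var 1).tail.head)))

end Expr

open MLN.Expr in
/-- The program with main function `m`. -/
def prog (m : Expr) : Program :=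
  [m, nthBody, setBody, orBody, fvBody, evBody, evAllBody, grBody, grAllBody, wtBody, compBody,
    mapConsBody, rowKeyBody, insBody, extendBody, extendAllBody, itemsBody, lengthBody, blankBody,
    totalBody, bestBody]

/-! ### Correctness and running time of the functions of the program -/

section
open Val

/-! ### Unary numerals, list access, and sets of variables as lists of marks -/

@[simp] theorem Val.ofNat_zero : ofNat 0 = nil := rfl
@[simp] theorem Val.ofNat_succ (k : ℕ) : ofNat (k + 1) = cons nil (ofNat k) := rfl
@[simp] theorem Val.ofNat_one : ofNat 1 = cons nil nil := rfl
@[simp] theorem Val.ofNat_two : ofNat 2 = cons nil (cons nil nil) := rfl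
@[simp] theorem Val.ofNat_three : ofNat 3 = cons nil (cons nil (cons nil nil)) := rfl
@[simp] theorem Val.isCons_cons (a b : Val) : (cons a b).IsCons := trivial
@[simp] theorem Val.not_isCons_nil : ¬ nil.IsCons := id
@[simp] theorem Val.not_isCons_num (r : ℝ) : ¬ (num r).IsCons := id
@[simp] theorem Val.head_cons (a b : Val) : (cons a b).head = a := rfl
@[simp] theorem Val.tail_cons (a b : Val) : (cons a b).tail = b := rfl
@[simp] theorem Val.head_nil : nil.head = nil := rfl
@[simp] theorem Val.tail_nil : nil.tail = nil := rfl
@[simp] theorem Val.toReal_num (r : ℝ) : (num r).toReal = r := rfl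
@[simp] theorem Val.ofList_nil : ofList [] = nil := rfl
@[simp] theorem Val.ofList_cons (a : Val) (l : List Val) :
    ofList (a :: l) = cons a (ofList l) := rfl

/-- Entry number `i` of a list. -/
def Val.nth : ℕ → Val → Val
  | 0, l => l.head
  | i + 1, l => nth i l.tail

/-- Replace entry number `i` of a list, which is padded with `nil` if necessary. -/
def Val.set : ℕ → Val → Val → Val
  | 0, x, l => cons x l.tail
  | i + 1, x, l => cons l.head (set i x l.tail)

theorem Val.nth_nil (i : ℕ) : nth i nil = nil := by
  induction i with
  | zero => rfl
  | succ i ih => exact ih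

theorem Val.nth_set (i : ℕ) (x : Val) :
    ∀ (j : ℕ) (l : Val), nth j (set i x l) = if j = i then x else nth j l := by
  induction i with
  | zero => rintro (_ | j) l <;> simp [set, nth]
  | succ i ih => rintro (_ | j) l <;> simp [set, nth, ih]

/-- Union of sets of natural numbers that are given by lists of marks. -/
def Val.union : Val → Val → Val
  | cons (cons a b) s, t => cons (cons a b) (union s t.tail)
  | cons _ s, t => cons t.head (union s t.tail)
  | _, t => t

theorem Val.isCons_nth_union (s t : Val) (i : ℕ) :
    (nth i (union s t)).IsCons ↔ (nth i s).IsCons ∨ (nth i t).IsCons := by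
  induction s generalizing t i with
  | nil => simp [union, nth_nil]
  | num r => cases i <;> simp [union, nth, head, tail, nth_nil]
  | cons a s iha ihs => cases a <;> cases i <;> simp [union, nth, ihs]

/-- The list of marks of the free variables of a formula. -/
def Formula.marks {N : ℕ} : Formula N → Val
  | .atom _ v => set v (cons nil nil) nil
  | .neg f => f.marks
  | .and f g => union f.marks g.marks
  | .all v f => set v nil f.marks

theorem Formula.isCons_nth_marks {N : ℕ} (f : Formula N) (i : ℕ) :
    (nth i f.marks).IsCons ↔ i ∈ f.freeVars := by
  induction f with
  | atom p v => by_cases h : i = v <;> simp [marks, freeVars, nth_set, nth_nil, h]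
  | neg f ih => exact ih
  | and f g ihf ihg => simp [marks, freeVars, isCons_nth_union, ihf, ihg]
  | all v f ih => by_cases h : i = v <;> simp [marks, freeVars, nth_set, ih, h]

/-- The variables given by a list of marks, the first of which is for variable `i`. -/
def Val.vars : ℕ → Val → List ℕ
  | i, .cons (.cons _ _) s => i :: vars (i + 1) s
  | i, .cons _ s => vars (i + 1) s
  | _, _ => []

theorem Val.mem_vars (s : Val) (i j : ℕ) :
    j ∈ vars i s ↔ i ≤ j ∧ (nth (j - i) s).IsCons := by
  induction s generalizing i with
  | nil => simp [vars, nth_nil]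
  | num r =>
    rcases h : j - i with _ | k <;> simp [vars, nth, head, tail, nth_nil]
  | cons a s iha ihs =>
    rcases lt_trichotomy i j with h | rfl | h
    · obtain ⟨k, rfl⟩ := Nat.exists_eq_add_of_lt h
      have e1 : i + k + 1 - i = k + 1 := by omega
      have e2 : i + k + 1 - (i + 1) = k := by omega
      have e3 : i + 1 ≤ i + k + 1 := by omega
      have e4 : i ≤ i + k + 1 := by omega
      have e5 : i + k + 1 ≠ i := by omega
      cases a <;> simp [vars, ihs, nth, e1, e2, e3, e4, e5]
    · cases a <;> simp [vars, ihs, nth]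
    · cases a <;> simp [vars, ihs] <;> omega

/-- Each free variable gets exactly one loop, so that every grounding is counted once. -/
theorem Val.nodup_vars (s : Val) (i : ℕ) : (vars i s).Nodup := by
  induction s generalizing i with
  | nil => simp [vars]
  | num r => simp [vars]
  | cons a s iha ihs =>
    cases a <;> simp [vars, ihs, mem_vars]

/-! #### Worlds as lists of rows -/

def encRow (r : List Bool) : Val := ofList (r.map fun b => ofOptionBool (some b))

def encRows (R : List (List Bool)) : Val := ofList (R.map encRow)

def encBool (b : Bool) : Val := if b then cons nil nil else nil

@[simp] theorem encRow_nil : encRow [] = nil := rfl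
@[simp] theorem encRow_cons (b : Bool) (r : List Bool) :
    encRow (b :: r) = cons (ofOptionBool (some b)) (encRow r) := rfl
@[simp] theorem encRows_nil : encRows [] = nil := rfl
@[simp] theorem encRows_cons (r : List Bool) (R : List (List Bool)) :
    encRows (r :: R) = cons (encRow r) (encRows R) := rfl
@[simp] theorem encBool_true : encBool true = cons nil nil := rfl
@[simp] theorem encBool_false : encBool false = nil := rfl

/-- The list `env` represents the map `E` from variables to rows. -/
def EnvRep (env : Val) (E : ℕ → List Bool) : Prop := ∀ i, nth i env = encRow (E i)

theorem EnvRep.nil : EnvRep nil fun _ => [] := fun i => nth_nil i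

theorem EnvRep.set {env : Val} {E : ℕ → List Bool} (h : EnvRep env E) (i : ℕ) (r : List Bool) :
    EnvRep (set i (encRow r) env) (Function.update E i r) := by
  intro j
  by_cases hj : j = i
  · subst hj; simp [nth_set]
  · simp [nth_set, hj, h j]

/-- Entries are the unary numerals 1 for false and 2 for true, and a missing entry reads as `nil`;
so only true has a pair as its tail. -/
theorem isCons_tail_nth_encRow (p : ℕ) (r : List Bool) :
    (nth p (encRow r)).tail.IsCons ↔ r.getD p false = true := by
  induction r generalizing p with
  | nil => simp [nth_nil]
  | cons b r ih =>
    cases p with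
    | zero => cases b <;> simp [nth, ofOptionBool]
    | succ p => simpa [nth] using ih p

/-- Truth of a formula in the world with rows `R` when the variables stand for the rows `E`. -/
def holdsRows {N : ℕ} (R : List (List Bool)) : Formula N → (ℕ → List Bool) → Bool
  | .atom p v, E => (E v).getD p false
  | .neg f, E => !(holdsRows R f E)
  | .and f g, E => holdsRows R f E && holdsRows R g E
  | .all v f, E => R.all fun r => holdsRows R f (Function.update E v r)

/-- The product of the factors of all instantiations of the variables `vs` by rows. -/
noncomputable def prodRows {N : ℕ} (R : List (List Bool)) (w : ℝ) (f : Formula N) :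
    List ℕ → (ℕ → List Bool) → ℝ
  | [], E => if holdsRows R f E = true then w else 1
  | v :: vs, E => (R.map fun r => prodRows R w f vs (Function.update E v r)).prod

/-- The weight of the world with rows `R`. -/
noncomputable def weightRows {N : ℕ} (Δ : Network N) (R : List (List Bool)) : ℝ :=
  (Δ.map fun wf => prodRows R (Real.exp wf.1) wf.2 (vars 0 wf.2.marks) fun _ => []).prod

/-- Here `n` is the number of rows. Each quantifier multiplies the bound by `n`, so the degree is at
most the quantifier depth; the constants are generous. -/
def evTime (n : ℕ) {N : ℕ} : Formula N → ℕ
  | .atom p v => 20 * p + 20 * v + 100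
  | .neg f => evTime n f + 60
  | .and f g => evTime n f + evTime n g + 100
  | .all v f => (evTime n f + 30 * v + 100) * n + 100

/-- Every marked variable opens a loop over `n` rows, and `T` bounds the evaluation of the formula
for one instantiation. -/
def grTime (n T : ℕ) : ℕ → Val → ℕ
  | i, .cons (.cons _ _) s => (grTime n T (i + 1) s + 30 * i + 100) * n + 100
  | i, .cons _ s => grTime n T (i + 1) s + 100
  | _, _ => T + 100

/-! ### Evaluation of formulas and weights -/

variable {m : Expr}

/-- The auxiliary functions never call function 0, so the specifications hold for every main
function `m` and serve both algorithms. -/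
theorem computes_nth (i : ℕ) : ∀ l, Computes (prog m) 1 (cons (ofNat i) l) (nth i l)
    (20 * i + 20) := by
  induction i with
  | zero =>
    intro l
    refine .of_wp (body := Expr.nthBody) rfl ?_
    simp [Expr.nthBody, wp, Val.nth]
  | succ i ih =>
    intro l
    refine .of_wp (body := Expr.nthBody) rfl ?_
    simp [Expr.nthBody, wp, Val.nth]
    exact ⟨_, ih _, by omega⟩

theorem computes_set (i : ℕ) (x : Val) : ∀ l,
    Computes (prog m) 2 (cons (ofNat i) (cons x l)) (set i x l) (30 * i + 30) := by
  induction i with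
  | zero =>
    intro l
    refine .of_wp (body := Expr.setBody) rfl ?_
    simp [Expr.setBody, wp, Val.set]
  | succ i ih =>
    intro l
    refine .of_wp (body := Expr.setBody) rfl ?_
    simp [Expr.setBody, wp, Val.set]
    exact ⟨_, ih _, by omega⟩

/-- Marks come from the formulas alone, so any finite time is constant in the domain size and no
explicit bound is kept. -/
theorem computes_union (s t : Val) :
    ∃ T, Computes (prog m) 3 (cons s t) (union s t) T := by
  induction s generalizing t with
  | nil =>
    refine ⟨100, .of_wp (body := Expr.orBody) rfl ?_⟩
    simp [Expr.orBody, wp, union]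
  | num r =>
    refine ⟨100, .of_wp (body := Expr.orBody) rfl ?_⟩
    simp [Expr.orBody, wp, union]
  | cons a s iha ihs =>
    obtain ⟨T, hT⟩ := ihs t.tail
    refine ⟨T + 100, .of_wp (body := Expr.orBody) rfl ?_⟩
    cases a <;> simp [Expr.orBody, wp, union] <;> exact ⟨_, hT, by omega⟩

theorem computes_marks {N : ℕ} (f : Formula N) :
    ∃ T, Computes (prog m) 4 (ofFormula f) f.marks T := by
  induction f with
  | atom p v =>
    refine ⟨30 * v + 100, .of_wp (body := Expr.fvBody) rfl ?_⟩
    simp [Expr.fvBody, wp, ofFormula, Formula.marks]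
    exact ⟨_, computes_set v _ _, by omega⟩
  | neg f ih =>
    obtain ⟨T, hT⟩ := ih
    refine ⟨T + 100, .of_wp (body := Expr.fvBody) rfl ?_⟩
    simp [Expr.fvBody, wp, ofFormula, Formula.marks]
    exact ⟨_, hT, by omega⟩
  | and f g ihf ihg =>
    obtain ⟨T, hT⟩ := ihf
    obtain ⟨T', hT'⟩ := ihg
    obtain ⟨T'', hT''⟩ := computes_union (m := m) f.marks g.marks
    refine ⟨T + T' + T'' + 100, .of_wp (body := Expr.fvBody) rfl ?_⟩
    simp [Expr.fvBody, wp, ofFormula, Formula.marks]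
    exact ⟨_, _, hT, _, _, hT', _, hT'', by omega⟩
  | all v f ih =>
    obtain ⟨T, hT⟩ := ih
    refine ⟨T + 30 * v + 100, .of_wp (body := Expr.fvBody) rfl ?_⟩
    simp [Expr.fvBody, wp, ofFormula, Formula.marks]
    exact ⟨_, _, hT, _, computes_set v _ _, by omega⟩

/-- Functions 5 and 6 call each other. The specification of 5 for the subformula is the hypothesis
`hf`, to be supplied by the induction hypothesis in `computes_holds`. The loop consumes `L`, while
the world `R` in which `f` is evaluated stays fixed. -/
theorem computes_holdsAll {N : ℕ} (R : List (List Bool)) (v : ℕ) (f : Formula N) {T : ℕ}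
    {env : Val} {E : ℕ → List Bool} (hE : EnvRep env E)
    (hf : ∀ env E, EnvRep env E → Computes (prog m) 5 (cons (ofFormula f) (cons env (encRows R)))
      (encBool (holdsRows R f E)) T) (L : List (List Bool)) :
    Computes (prog m) 6
      (cons (encRows L) (cons (cons (ofNat v) (ofFormula f)) (cons env (encRows R))))
      (encBool (L.all fun r => holdsRows R f (Function.update E v r)))
      ((T + 30 * v + 100) * L.length + 10) := by
  induction L with
  | nil =>
    refine .of_wp (body := Expr.evAllBody) rfl ?_
    simp [Expr.evAllBody, wp]
  | cons r L ih =>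
    refine .of_wp (body := Expr.evAllBody) rfl ?_
    have hr := hf _ _ (hE.set v r)
    simp [Expr.evAllBody, wp]
    refine ⟨_, _, computes_set v _ _, _, _, hr, ?_⟩
    cases holdsRows R f (Function.update E v r)
    · simp
      nlinarith
    · simp
      refine ⟨_, ih, ?_⟩
      nlinarith

theorem computes_holds {N : ℕ} (R : List (List Bool)) (f : Formula N) : ∀ env E, EnvRep env E →
    Computes (prog m) 5 (cons (ofFormula f) (cons env (encRows R)))
      (encBool (holdsRows R f E)) (evTime R.length f) := by
  induction f with
  | atom p v =>
    intro env E hE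
    refine .of_wp (body := Expr.evBody) rfl ?_
    simp [Expr.evBody, wp, ofFormula]
    refine ⟨_, _, computes_nth v _, _, _, computes_nth p _, ?_⟩
    rw [hE v, isCons_tail_nth_encRow, holdsRows, evTime]
    cases (E v).getD p false <;> simp <;> omega
  | neg f ih =>
    intro env E hE
    refine .of_wp (body := Expr.evBody) rfl ?_
    simp [Expr.evBody, wp, ofFormula]
    refine ⟨_, _, ih _ _ hE, ?_⟩
    rw [holdsRows, evTime]
    cases holdsRows R f E <;> simp <;> omega
  | and f g ihf ihg =>
    intro env E hE
    refine .of_wp (body := Expr.evBody) rfl ?_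
    simp [Expr.evBody, wp, ofFormula]
    refine ⟨_, _, ihf _ _ hE, ?_⟩
    rw [holdsRows, evTime]
    cases holdsRows R f E
    · simp
      omega
    · simp
      exact ⟨_, ihg _ _ hE, by omega⟩
  | all v f ih =>
    intro env E hE
    refine .of_wp (body := Expr.evBody) rfl ?_
    simp [Expr.evBody, wp, ofFormula]
    refine ⟨_, computes_holdsAll R v f hE ih R, ?_⟩
    rw [evTime]
    omega

theorem computes_prodAll {N : ℕ} (R : List (List Bool)) (w : ℝ) (f : Formula N) (i : ℕ) (s : Val)
    {T : ℕ} {env : Val} {E : ℕ → List Bool} (hE : EnvRep env E)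
    (hs : ∀ env E, EnvRep env E → Computes (prog m) 7 (cons s (cons (ofNat (i + 1)) (cons env
      (cons (encRows R) (cons (num w) (ofFormula f))))))
      (num (prodRows R w f (vars (i + 1) s) E)) T) (L : List (List Bool)) :
    Computes (prog m) 8 (cons (encRows L) (cons s (cons (ofNat i) (cons env
      (cons (encRows R) (cons (num w) (ofFormula f)))))))
      (num (L.map fun r => prodRows R w f (vars (i + 1) s) (Function.update E i r)).prod)
      ((T + 30 * i + 100) * L.length + 10) := by
  induction L with
  | nil =>
    refine .of_wp (body := Expr.grAllBody) rfl ?_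
    simp [Expr.grAllBody, wp]
  | cons r L ih =>
    refine .of_wp (body := Expr.grAllBody) rfl ?_
    have hr := hs _ _ (hE.set i r)
    simp [Expr.grAllBody, wp, -List.map_map]
    refine ⟨_, _, computes_set i _ _, _, _, hr, _, _, ih, ?_, ?_⟩
    · simp [Op.apply]
    · nlinarith

theorem computes_prod {N : ℕ} (R : List (List Bool)) (w : ℝ) (f : Formula N) (s : Val) :
    ∀ i env E, EnvRep env E → Computes (prog m) 7 (cons s (cons (ofNat i) (cons env
      (cons (encRows R) (cons (num w) (ofFormula f))))))
      (num (prodRows R w f (vars i s) E)) (grTime R.length (evTime R.length f) i s) := by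
  have leaf (s : Val) (hs : ¬ s.IsCons) : ∀ i env E, EnvRep env E → Computes (prog m) 7 (cons s
      (cons (ofNat i) (cons env (cons (encRows R) (cons (num w) (ofFormula f))))))
      (num (prodRows R w f [] E)) (evTime R.length f + 100) := by
    intro i env E hE
    refine .of_wp (body := Expr.grBody) rfl ?_
    simp [Expr.grBody, wp, hs]
    refine ⟨_, _, computes_holds R f _ _ hE, ?_⟩
    rw [prodRows]
    cases holdsRows R f E <;> simp <;> omega
  induction s with
  | nil => exact leaf _ (by simp)
  | num r => exact leaf _ (by simp)
  | cons a s iha ihs =>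
    intro i env E hE
    by_cases ha : a.IsCons
    · cases a <;> first | exact ha.elim | skip
      refine .of_wp (body := Expr.grBody) rfl ?_
      simp [Expr.grBody, wp, grTime, vars, prodRows]
      refine ⟨_, computes_prodAll R w f i s hE (ihs (i + 1)) R, ?_⟩
      omega
    · have h1 : vars i (cons a s) = vars (i + 1) s := by
        cases a <;> first | rfl | exact (ha trivial).elim
      have h2 : grTime R.length (evTime R.length f) i (cons a s) =
          grTime R.length (evTime R.length f) (i + 1) s + 100 := by
        cases a <;> first | rfl | exact (ha trivial).elim
      rw [h1, h2]
      refine .of_wp (body := Expr.grBody) rfl ?_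
      simp [Expr.grBody, wp, ha]
      refine ⟨_, ihs (i + 1) _ _ hE, ?_⟩
      omega

/-- Functions given by a polynomial. -/
def IsPoly (T : ℕ → ℕ) : Prop := ∃ q : Polynomial ℕ, ∀ n, T n = q.eval n

theorem IsPoly.const (c : ℕ) : IsPoly fun _ => c := ⟨.C c, by simp⟩

theorem IsPoly.id : IsPoly fun n => n := ⟨.X, by simp⟩

theorem IsPoly.add {S T : ℕ → ℕ} (hS : IsPoly S) (hT : IsPoly T) : IsPoly fun n => S n + T n := by
  obtain ⟨p, hp⟩ := hS
  obtain ⟨q, hq⟩ := hT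
  exact ⟨p + q, by simp [hp, hq]⟩

theorem IsPoly.mul {S T : ℕ → ℕ} (hS : IsPoly S) (hT : IsPoly T) : IsPoly fun n => S n * T n := by
  obtain ⟨p, hp⟩ := hS
  obtain ⟨q, hq⟩ := hT
  exact ⟨p * q, by simp [hp, hq]⟩

theorem IsPoly.pow {S : ℕ → ℕ} (hS : IsPoly S) (k : ℕ) : IsPoly fun n => S n ^ k := by
  obtain ⟨p, hp⟩ := hS
  exact ⟨p ^ k, by simp [hp]⟩

theorem isPoly_evTime {N : ℕ} (f : Formula N) : IsPoly fun n => evTime n f := by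
  induction f with
  | atom p v => exact .const _
  | neg f ih => exact ih.add (.const _)
  | and f g ihf ihg => exact (ihf.add ihg).add (.const _)
  | all v f ih => exact (((ih.add (.const _)).add (.const _)).mul .id).add (.const _)

theorem isPoly_grTime {T : ℕ → ℕ} (hT : IsPoly T) (s : Val) :
    ∀ i, IsPoly fun n => grTime n (T n) i s := by
  induction s with
  | nil => exact fun i => hT.add (.const _)
  | num r => exact fun i => hT.add (.const _)
  | cons a s iha ihs =>
    intro i
    cases a with
    | cons b c => exact ((((ihs (i + 1)).add (.const _)).add (.const _)).mul .id).add (.const _)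
    | _ => exact (ihs (i + 1)).add (.const _)

theorem computes_weight {N : ℕ} (Δ : Network N) : ∃ T, IsPoly T ∧ ∀ R : List (List Bool),
    Computes (prog m) 9 (cons (ofNetwork Δ) (encRows R)) (num (weightRows Δ R)) (T R.length) := by
  induction Δ with
  | nil =>
    refine ⟨_, .const 100, fun R => .of_wp (body := Expr.wtBody) rfl ?_⟩
    simp [Expr.wtBody, wp, ofNetwork, weightRows]
  | cons wf Δ ih =>
    obtain ⟨T, hT, h⟩ := ih
    obtain ⟨K, hK⟩ := computes_marks (m := m) wf.2
    refine ⟨_, (hT.add (isPoly_grTime (isPoly_evTime wf.2) wf.2.marks 0)).add (.const (K + 100)),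
      fun R => .of_wp (body := Expr.wtBody) rfl ?_⟩
    simp [Expr.wtBody, wp, ofNetwork]
    refine ⟨_, _, hK, _, _, computes_prod R _ wf.2 _ 0 _ _ .nil, _, _, h R, ?_, ?_⟩
    · simp [weightRows, Op.apply]
    · omega

end
section
open Val

/-! #### Lists of items -/

def encPartial (r : List (Option Bool)) : Val := ofList (r.map ofOptionBool)

@[simp] theorem encPartial_nil : encPartial [] = nil := rfl
@[simp] theorem encPartial_cons (b : Option Bool) (r : List (Option Bool)) :
    encPartial (b :: r) = cons (ofOptionBool b) (encPartial r) := rfl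

def encTable (R : List (List (Option Bool))) : Val := ofList (R.map encPartial)

@[simp] theorem encTable_nil : encTable [] = nil := rfl
@[simp] theorem encTable_cons (r : List (Option Bool)) (R : List (List (Option Bool))) :
    encTable (r :: R) = cons (encPartial r) (encTable R) := rfl

/-- The completions of a row of evidence. -/
def completions : List (Option Bool) → List (List Bool)
  | [] => [[]]
  | some b :: r => (completions r).map (b :: ·)
  | none :: r => (completions r).map (false :: ·) ++ (completions r).map (true :: ·)

/-- `B ^ c` with `c` the binary code of the row. -/
def rowKey (B : ℕ) : List Bool → ℕ
  | [] => 1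
  | b :: r => rowKey B r * rowKey B r * if b then B else 1

/-- A class of partial worlds that are equal up to the order of the rows: its key, a
representative, and the number of partial worlds. -/
abbrev Item : Type := ℕ × List (List Bool) × ℕ

noncomputable def encItem (it : Item) : Val := cons (num it.1) (cons (encRows it.2.1) (num it.2.2))

noncomputable def encItems (L : List Item) : Val := ofList (L.map encItem)

@[simp] theorem encItems_nil : encItems [] = nil := rfl
@[simp] theorem encItems_cons (it : Item) (L : List Item) :
    encItems (it :: L) = cons (encItem it) (encItems L) := rfl

/-- Merge an item into a list of items. -/
def insertItem (it : Item) : List Item → List Item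
  | [] => [it]
  | h :: L => if it.1 = h.1 then (h.1, h.2.1, h.2.2 + it.2.2) :: L else h :: insertItem it L

def extendItem (B : ℕ) (it : Item) (r : List Bool) : Item :=
  (it.1 + rowKey B r, r :: it.2.1, it.2.2)

/-- Add the extensions of an item by the rows `C`. -/
def extend (B : ℕ) (C : List (List Bool)) (acc : List Item) (it : Item) : List Item :=
  C.foldl (fun acc r => insertItem (extendItem B it r) acc) acc

def items (B : ℕ) : List (List (Option Bool)) → List Item
  | [] => [(0, [], 1)]
  | r :: R => (items B R).foldl (extend B (completions r)) []

theorem length_completions_le (r : List (Option Bool)) : (completions r).length ≤ 2 ^ r.length := by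
  induction r with
  | nil => simp [completions]
  | cons b r ih => cases b <;> simp [completions, pow_succ] <;> omega

variable {m : Expr}

theorem computes_mapCons (b : Bool) (C : List (List Bool)) (acc : List (List Bool)) :
    Computes (prog m) 11 (cons (ofOptionBool (some b)) (cons (encRows C) (encRows acc)))
      (encRows (C.map (b :: ·) ++ acc)) (40 * C.length + 10) := by
  induction C with
  | nil =>
    refine .of_wp (body := Expr.mapConsBody) rfl ?_
    simp [Expr.mapConsBody, wp]
  | cons r C ih =>
    refine .of_wp (body := Expr.mapConsBody) rfl ?_
    simp [Expr.mapConsBody, wp]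
    exact ⟨_, ih, by omega⟩

def compTime : ℕ → ℕ
  | 0 => 10
  | k + 1 => compTime k + 80 * 2 ^ k + 100

theorem computes_completions (r : List (Option Bool)) :
    Computes (prog m) 10 (encPartial r) (encRows (completions r)) (compTime r.length) := by
  induction r with
  | nil =>
    refine .of_wp (body := Expr.compBody) rfl ?_
    simp [Expr.compBody, wp, completions, compTime]
  | cons b r ih =>
    have hl := length_completions_le r
    refine .of_wp (body := Expr.compBody) rfl ?_
    rcases b with _ | b
    · have h1 := computes_mapCons (m := m) true (completions r) []
      have h2 := computes_mapCons (m := m) false (completions r)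
        ((completions r).map (true :: ·))
      simp only [List.append_nil] at h1
      simp [Expr.compBody, wp, completions, compTime, ofOptionBool]
      exact ⟨_, _, ih, _, _, h1, _, h2, by omega⟩
    · have h1 := computes_mapCons (m := m) b (completions r) []
      have h0 : (ofOptionBool (some b)).IsCons := by cases b <;> trivial
      simp only [List.append_nil] at h1
      simp [Expr.compBody, wp, completions, compTime, h0]
      exact ⟨_, _, ih, _, h1, by omega⟩

theorem computes_rowKey (B : ℕ) (r : List Bool) :
    Computes (prog m) 12 (cons (num B) (encRow r)) (num (rowKey B r)) (60 * r.length + 10) := by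
  induction r with
  | nil =>
    refine .of_wp (body := Expr.rowKeyBody) rfl ?_
    simp [Expr.rowKeyBody, wp, rowKey]
  | cons b r ih =>
    refine .of_wp (body := Expr.rowKeyBody) rfl ?_
    simp [Expr.rowKeyBody, wp, rowKey]
    refine ⟨_, _, ih, ?_⟩
    cases b <;> simp [ofOptionBool, Op.apply] <;> omega

theorem computes_insertItem (it : Item) (L : List Item) :
    Computes (prog m) 13 (cons (encItem it) (encItems L)) (encItems (insertItem it L))
      (60 * L.length + 20) := by
  induction L with
  | nil =>
    refine .of_wp (body := Expr.insBody) rfl ?_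
    simp [Expr.insBody, wp, insertItem]
  | cons h L ih =>
    refine .of_wp (body := Expr.insBody) rfl ?_
    rw [encItem] at *
    rcases lt_trichotomy it.1 h.1 with hlt | heq | hlt
    · simp [Expr.insBody, wp, insertItem, encItem, hlt, hlt.ne]
      exact ⟨_, ih, by omega⟩
    · simp [Expr.insBody, wp, insertItem, encItem, heq, Op.apply]
      omega
    · simp [Expr.insBody, wp, insertItem, encItem, hlt, hlt.ne', hlt.le, not_lt]
      exact ⟨_, ih, by omega⟩

end

/-! ### Keys -/

def rowCode : List Bool → ℕ
  | [] => 0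
  | b :: r => 2 * rowCode r + if b then 1 else 0

theorem rowKey_eq (B : ℕ) (r : List Bool) : rowKey B r = B ^ rowCode r := by
  induction r with
  | nil => rfl
  | cons b r ih => cases b <;> simp [rowKey, rowCode, ih] <;> ring

theorem rowCode_lt (r : List Bool) : rowCode r < 2 ^ r.length := by
  induction r with
  | nil => simp [rowCode]
  | cons b r ih => cases b <;> simp [rowCode, pow_succ] <;> omega

theorem eq_of_rowCode_eq {r s : List Bool} (hl : r.length = s.length)
    (h : rowCode r = rowCode s) : r = s := by
  induction r generalizing s with
  | nil => simpa [eq_comm] using hl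
  | cons b r ih =>
    cases s with
    | nil => simp at hl
    | cons c s =>
      have : b = c ∧ rowCode r = rowCode s := by
        cases b <;> cases c <;> simp [rowCode] at h ⊢ <;> omega
      rw [this.1, ih (by simpa using hl) this.2]

/-- Collecting equal exponents turns the sum into a base-`B` expansion whose digits are the
multiplicities. -/
theorem sum_pow_eq_ofDigits (B m : ℕ) (l : List ℕ) (hl : ∀ i ∈ l, i < m) :
    (l.map (B ^ ·)).sum = Nat.ofDigits B ((List.range m).map (l.count ·)) := by
  have h : Nat.ofDigits B ((List.range m).map (l.count ·)) =
      ∑ i ∈ Finset.range m, l.count i * B ^ i := by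
    rw [Nat.ofDigits_eq_sum_mapIdx, List.mapIdx_eq_ofFn, List.sum_ofFn]
    simp only [List.get_eq_getElem, List.getElem_map, List.getElem_range]
    rw [Fin.sum_univ_eq_sum_range fun i => l.count i * B ^ i, List.length_map, List.length_range]
  rw [h, Finset.sum_list_map_count]
  simp only [smul_eq_mul]
  refine Finset.sum_subset (fun i hi => by simpa using hl i (by simpa using hi)) ?_
  intro i _ hi
  rw [List.count_eq_zero_of_not_mem (by simpa using hi), zero_mul]

/-- Multiplicities are bounded by the lengths, hence are genuine base-`B` digits, and expansions of
equal length are unique. -/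
theorem perm_of_sum_pow_eq {B : ℕ} {l l' : List ℕ} (hl : l.length < B) (hl' : l'.length < B)
    (h : (l.map (B ^ ·)).sum = (l'.map (B ^ ·)).sum) : l.Perm l' := by
  obtain ⟨m, hm⟩ : ∃ m, ∀ i ∈ l ++ l', i < m :=
    ⟨(l ++ l').sum + 1, fun i hi => Nat.lt_succ_of_le (List.single_le_sum (by simp) i hi)⟩
  simp only [List.mem_append] at hm
  rw [sum_pow_eq_ofDigits B m l fun i hi => hm i (.inl hi),
    sum_pow_eq_ofDigits B m l' fun i hi => hm i (.inr hi)] at h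
  by_cases hB : 1 < B
  · have key := Nat.ofDigits_inj_of_len_eq hB (by simp)
      (by simpa using fun i _ => (List.count_le_length).trans_lt hl)
      (by simpa using fun i _ => (List.count_le_length).trans_lt hl') h
    rw [List.perm_iff_count]
    intro i
    by_cases hi : i < m
    · simpa [List.getElem?_range hi] using congrArg (·[i]?.getD 0) key
    · rw [List.count_eq_zero_of_not_mem fun h => hi (hm i (.inl h)),
        List.count_eq_zero_of_not_mem fun h => hi (hm i (.inr h))]
  -- The case `B ≤ 1`, which the empty domain produces: lengths below `B` leave only empty lists.
  · have h1 : l = [] := List.eq_nil_of_length_eq_zero (by omega)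
    have h2 : l' = [] := List.eq_nil_of_length_eq_zero (by omega)
    rw [h1, h2]

def worldKey (B : ℕ) (R : List (List Bool)) : ℕ := (R.map (rowKey B)).sum

/-- The key determines the multiset of row codes. Codes are injective on rows of length `N`, so
mapping a left inverse over the permuted codes recovers a permutation of the rows. -/
theorem perm_of_worldKey_eq {B N : ℕ} {R S : List (List Bool)} (hR : R.length < B)
    (hS : S.length < B) (hR' : ∀ r ∈ R, r.length = N) (hS' : ∀ r ∈ S, r.length = N)
    (h : worldKey B R = worldKey B S) : R.Perm S := by
  have h1 : (R.map rowCode).Perm (S.map rowCode) := by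
    refine perm_of_sum_pow_eq (B := B) (by simpa) (by simpa) ?_
    have hB : rowKey B = fun r => B ^ rowCode r := funext (rowKey_eq B)
    simpa only [worldKey, List.map_map, Function.comp_def, hB] using h
  have hinj : Set.InjOn rowCode {r | r.length = N} :=
    fun r hr s hs h => eq_of_rowCode_eq (Eq.trans hr (Eq.symm hs)) h
  have hinv (T : List (List Bool)) (hT : ∀ r ∈ T, r.length = N) :
      (T.map rowCode).map (Function.invFunOn rowCode {r | r.length = N}) = T := by
    rw [List.map_map]
    exact (List.map_congr_left fun r hr => hinj.leftInvOn_invFunOn (hT r hr)).trans T.map_id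
  have h2 := h1.map (Function.invFunOn rowCode {r | r.length = N})
  rwa [hinv R hR', hinv S hS'] at h2

/-! ### The classes of partial worlds -/

/-- The worlds that agree with a table. -/
def tableWorlds : List (List (Option Bool)) → List (List (List Bool))
  | [] => [[]]
  | r :: R => (tableWorlds R).flatMap fun S => (completions r).map (· :: S)

theorem length_of_mem_completions {r : List (Option Bool)} {s : List Bool}
    (h : s ∈ completions r) : s.length = r.length := by
  induction r generalizing s with
  | nil => simp_all [completions]
  | cons b r ih =>
    cases b <;> simp [completions] at h <;> grind

theorem length_of_mem_tableWorlds {N : ℕ} {R : List (List (Option Bool))}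
    (hR : ∀ r ∈ R, r.length = N) {S : List (List Bool)} (h : S ∈ tableWorlds R) :
    S.length = R.length ∧ ∀ s ∈ S, s.length = N := by
  induction R generalizing S with
  | nil => simp_all [tableWorlds]
  | cons r R ih =>
    simp only [tableWorlds, List.mem_flatMap, List.mem_map] at h
    obtain ⟨S, hS, s, hs, rfl⟩ := h
    obtain ⟨h1, h2⟩ := ih (fun r hr => hR r (by simp [hr])) hS
    refine ⟨by simp [h1], ?_⟩
    intro t ht
    rcases List.mem_cons.1 ht with rfl | ht
    · rw [length_of_mem_completions hs, hR r (by simp)]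
    · exact h2 t ht

/-- The items have different keys, and their representatives are in `A`. -/
structure IsItemList (B : ℕ) (A : Set (List (List Bool))) (L : List Item) : Prop where
  nodup : (L.map (·.1)).Nodup
  mem : ∀ it ∈ L, it.1 = worldKey B it.2.1 ∧ it.2.1 ∈ A

theorem IsItemList.nil (B : ℕ) (A : Set (List (List Bool))) : IsItemList B A [] := by
  constructor <;> simp

/-- Merging changes only a count, so any property of key and representative survives. -/
theorem forall_mem_insertItem {p : ℕ → List (List Bool) → Prop} {it : Item} {L : List Item}
    (hit : p it.1 it.2.1) (hL : ∀ h ∈ L, p h.1 h.2.1) :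
    ∀ h ∈ insertItem it L, p h.1 h.2.1 := by
  induction L with
  | nil => simpa [insertItem] using hit
  | cons h L ih =>
    have h1 := hL h (by simp)
    have h2 : ∀ h ∈ L, p h.1 h.2.1 := fun k hk => hL k (by simp [hk])
    rw [insertItem]
    split
    · intro k hk
      rcases List.mem_cons.1 hk with rfl | hk
      · exact h1
      · exact h2 k hk
    · intro k hk
      rcases List.mem_cons.1 hk with rfl | hk
      · exact h1
      · exact ih h2 k hk

theorem keys_insertItem (it : Item) (L : List Item) : (insertItem it L).map (·.1) =
    if it.1 ∈ L.map (·.1) then L.map (·.1) else L.map (·.1) ++ [it.1] := by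
  induction L with
  | nil => simp [insertItem]
  | cons h L ih =>
    by_cases hk : it.1 = h.1
    · simp [insertItem, hk]
    · simp only [insertItem, hk, if_false, List.map_cons, ih, List.mem_cons, false_or]
      split <;> simp

theorem IsItemList.insertItem {B : ℕ} {A : Set (List (List Bool))} {L : List Item}
    (hL : IsItemList B A L) {it : Item} (hk : it.1 = worldKey B it.2.1) (hA : it.2.1 ∈ A) :
    IsItemList B A (insertItem it L) where
  nodup := by
    rw [keys_insertItem]
    split
    · exact hL.nodup
    · refine List.nodup_append.2 ⟨hL.nodup, by simp, ?_⟩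
      rintro a ha b hb rfl
      simp_all
  mem := forall_mem_insertItem (p := fun k S => k = worldKey B S ∧ S ∈ A) ⟨hk, hA⟩ hL.mem

theorem worldKey_le {B N : ℕ} (hB : 0 < B) {S : List (List Bool)} (hS : ∀ s ∈ S, s.length = N) :
    worldKey B S ≤ S.length * B ^ 2 ^ N := by
  rw [worldKey, ← smul_eq_mul, ← List.length_map (rowKey B)]
  refine List.sum_le_card_nsmul _ _ fun k hk => ?_
  obtain ⟨s, hs, rfl⟩ := List.mem_map.1 hk
  rw [rowKey_eq]
  exact Nat.pow_le_pow_right hB (hS s hs ▸ (rowCode_lt s).le)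

/-- Distinct natural numbers below `M` are at most `M` in number; multisets need not be counted. -/
theorem IsItemList.length_le {B : ℕ} {A : Set (List (List Bool))} {L : List Item}
    (hL : IsItemList B A L) {M : ℕ} (hA : ∀ S ∈ A, worldKey B S < M) : L.length ≤ M := by
  have h : (L.map (·.1)).toFinset ⊆ Finset.range M := by
    intro k hk
    simp only [List.mem_toFinset, List.mem_map] at hk
    obtain ⟨it, hit, rfl⟩ := hk
    obtain ⟨h1, h2⟩ := hL.mem it hit
    simpa [h1] using hA _ h2
  simpa [List.toFinset_card_of_nodup hL.nodup] using Finset.card_le_card h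

theorem IsItemList.extend {B : ℕ} {A : Set (List (List Bool))} {it : Item}
    (hk : it.1 = worldKey B it.2.1) {C : List (List Bool)} (hC : ∀ r ∈ C, r :: it.2.1 ∈ A)
    {L : List Item} (hL : IsItemList B A L) : IsItemList B A (extend B C L it) := by
  induction C generalizing L with
  | nil => exact hL
  | cons r C ih =>
    refine ih (fun r hr => hC r (by simp [hr])) (hL.insertItem ?_ (hC r (by simp)))
    simp [extendItem, worldKey, hk, add_comm]

theorem IsItemList.extendAll {B : ℕ} {A A' : Set (List (List Bool))} {C : List (List Bool)}
    (hC : ∀ S ∈ A, ∀ r ∈ C, r :: S ∈ A') {L : List Item}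
    (hL : ∀ it ∈ L, it.1 = worldKey B it.2.1 ∧ it.2.1 ∈ A)
    {L' : List Item} (hL' : IsItemList B A' L') :
    IsItemList B A' (L.foldl (MLN.extend B C) L') := by
  induction L generalizing L' with
  | nil => exact hL'
  | cons it L ih =>
    exact ih (fun it hit => hL it (by simp [hit]))
      (hL'.extend (hL it (by simp)).1 (hC _ (hL it (by simp)).2))

theorem cons_mem_tableWorlds {r : List (Option Bool)} {R : List (List (Option Bool))}
    {S : List (List Bool)} (hS : S ∈ tableWorlds R) {s : List Bool} (hs : s ∈ completions r) :
    s :: S ∈ tableWorlds (r :: R) := by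
  simp only [tableWorlds, List.mem_flatMap, List.mem_map]
  exact ⟨S, hS, s, hs, rfl⟩

theorem isItemList_items (B : ℕ) (R : List (List (Option Bool))) :
    IsItemList B {S | S ∈ tableWorlds R} (items B R) := by
  induction R with
  | nil => constructor <;> simp [items, tableWorlds, worldKey]
  | cons r R ih =>
    exact .extendAll (A := {S | S ∈ tableWorlds R}) (fun S hS s hs => cons_mem_tableWorlds hS hs)
      ih.mem (.nil _ _)

/-- Sum over the partial worlds that the items stand for. -/
noncomputable def itemSum (F : List (List Bool) → ℝ) (L : List Item) : ℝ :=
  (L.map fun it => it.2.2 * F it.2.1).sum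

/-- A merge adds the new count to an older representative with the same key, where `F` has the same
value. -/
theorem itemSum_insertItem {B : ℕ} {A : Set (List (List Bool))} {F : List (List Bool) → ℝ}
    (hF : ∀ S ∈ A, ∀ S' ∈ A, worldKey B S = worldKey B S' → F S = F S') {it : Item}
    (hk : it.1 = worldKey B it.2.1) (hA : it.2.1 ∈ A)
    {L : List Item} (hL : ∀ it ∈ L, it.1 = worldKey B it.2.1 ∧ it.2.1 ∈ A) :
    itemSum F (insertItem it L) = it.2.2 * F it.2.1 + itemSum F L := by
  induction L with
  | nil => simp [insertItem, itemSum]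
  | cons h L ih =>
    obtain ⟨h1, h2⟩ := hL h (by simp)
    by_cases he : it.1 = h.1
    · simp only [insertItem, he, if_true, itemSum, List.map_cons, List.sum_cons, Nat.cast_add,
        hF _ hA _ h2 (by rw [← hk, ← h1, he])]
      ring
    · have := ih fun it hit => hL it (by simp [hit])
      simp only [itemSum] at this
      simp only [insertItem, he, if_false, itemSum, List.map_cons, List.sum_cons, this]
      ring

theorem itemSum_extend {B : ℕ} {A : Set (List (List Bool))} {F : List (List Bool) → ℝ}
    (hF : ∀ S ∈ A, ∀ S' ∈ A, worldKey B S = worldKey B S' → F S = F S') {it : Item}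
    (hk : it.1 = worldKey B it.2.1) {C : List (List Bool)} (hC : ∀ r ∈ C, r :: it.2.1 ∈ A)
    {L : List Item} (hL : IsItemList B A L) :
    itemSum F (extend B C L it) =
      it.2.2 * (C.map fun r => F (r :: it.2.1)).sum + itemSum F L := by
  induction C generalizing L with
  | nil => simp [extend]
  | cons r C ih =>
    have h1 : (extendItem B it r).1 = worldKey B (extendItem B it r).2.1 := by
      simp [extendItem, worldKey, hk, add_comm]
    have h2 : (extendItem B it r).2.1 ∈ A := hC r (by simp)
    have := ih (fun r hr => hC r (by simp [hr])) (hL.insertItem h1 h2)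
    rw [extend, List.foldl_cons, ← extend, this, itemSum_insertItem hF h1 h2 hL.mem]
    simp only [extendItem, List.map_cons, List.sum_cons]
    ring

theorem itemSum_extendAll {B : ℕ} {A A' : Set (List (List Bool))} {F : List (List Bool) → ℝ}
    (hF : ∀ S ∈ A', ∀ S' ∈ A', worldKey B S = worldKey B S' → F S = F S')
    {C : List (List Bool)} (hC : ∀ S ∈ A, ∀ r ∈ C, r :: S ∈ A')
    {L : List Item} (hL : ∀ it ∈ L, it.1 = worldKey B it.2.1 ∧ it.2.1 ∈ A)
    {L' : List Item} (hL' : IsItemList B A' L') :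
    itemSum F (L.foldl (extend B C) L') =
      itemSum (fun S => (C.map fun r => F (r :: S)).sum) L + itemSum F L' := by
  induction L generalizing L' with
  | nil => simp [itemSum]
  | cons it L ih =>
    have h1 := (hL it (by simp)).1
    have h2 := hC _ (hL it (by simp)).2
    rw [List.foldl_cons, ih (fun it hit => hL it (by simp [hit])) (hL'.extend h1 h2),
      itemSum_extend hF h1 h2 hL']
    simp only [itemSum, List.map_cons, List.sum_cons]
    ring

/-- Induction over the rows with `F` varying: summing out the first row replaces `F` by `S ↦ ∑ F (r
:: S)` over its completions `r`, again permutation invariant. Worlds have fewer than `B` rows, so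
equal keys do give permutations. -/
theorem itemSum_items {B N : ℕ} {R : List (List (Option Bool))} (hB : R.length < B)
    (hR : ∀ r ∈ R, r.length = N) {F : List (List Bool) → ℝ}
    (hF : ∀ S S', S.Perm S' → F S = F S') :
    itemSum F (items B R) = ((tableWorlds R).map F).sum := by
  induction R generalizing F with
  | nil => simp [itemSum, items, tableWorlds]
  | cons r R ih =>
    rw [items, itemSum_extendAll (A := {S | S ∈ tableWorlds R})
      (A' := {S | S ∈ tableWorlds (r :: R)}) (fun S hS S' hS' hk => hF _ _ ?_)
      (fun S hS s hs => cons_mem_tableWorlds hS hs) (isItemList_items B R).mem (.nil _ _),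
      ih (by simp at hB; omega) (fun r hr => hR r (by simp [hr]))]
    · simp only [itemSum, tableWorlds, List.map_flatMap, List.map_map, Function.comp_def,
        List.map_nil, List.sum_nil, add_zero]
      induction tableWorlds R with
      | nil => rfl
      | cons S L ih => simp [ih]
    · intro S S' h
      simp only [hF _ _ (h.cons _)]
    · obtain ⟨h1, h2⟩ := length_of_mem_tableWorlds hR hS
      obtain ⟨h3, h4⟩ := length_of_mem_tableWorlds hR hS'
      exact perm_of_worldKey_eq (by omega) (by omega) h2 h4 hk

-- Take the indicator of the permutation class of `S` as `F`: the sum over worlds is at least 1,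
-- because `S` contributes, so some item must contribute as well.
open Classical in
theorem exists_mem_items_perm {B N : ℕ} {R : List (List (Option Bool))} (hB : R.length < B)
    (hR : ∀ r ∈ R, r.length = N) {S : List (List Bool)} (hS : S ∈ tableWorlds R) :
    ∃ it ∈ items B R, it.2.1.Perm S := by
  by_contra! h
  have h1 := itemSum_items hB hR (F := fun S' => if S'.Perm S then 1 else 0) fun S₁ S₂ h12 => by
    simp only [h12.congr_left]
  have h2 : itemSum (fun S' => if S'.Perm S then 1 else 0) (items B R) = 0 := by
    refine List.sum_eq_zero fun x hx => ?_
    obtain ⟨it, hit, rfl⟩ := List.mem_map.1 hx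
    simp [h it hit]
  have h3 : (if S.Perm S then 1 else 0 : ℝ) ≤
      ((tableWorlds R).map fun S' => if S'.Perm S then (1 : ℝ) else 0).sum := by
    refine List.single_le_sum ?_ _ (List.mem_map.2 ⟨S, hS, rfl⟩)
    intro x hx
    obtain ⟨S', -, rfl⟩ := List.mem_map.1 hx
    positivity
  rw [← h1, h2] at h3
  norm_num at h3

/-! ### The remaining functions of the program -/

section
open Val

variable {m : Expr}

/-- All intermediate accumulators are item lists over `A`, so `M` bounds the cost of each insertion
uniformly. -/
theorem computes_extend {B N M : ℕ} {A : Set (List (List Bool))}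
    (hA : ∀ L, IsItemList B A L → L.length ≤ M) (it : Item) (hk : it.1 = worldKey B it.2.1)
    {C : List (List Bool)} (hC : ∀ r ∈ C, r.length = N ∧ r :: it.2.1 ∈ A)
    {L : List Item} (hL : IsItemList B A L) :
    Computes (prog m) 14 (cons (encRows C) (cons (encItem it) (cons (num B) (encItems L))))
      (encItems (extend B C L it)) ((60 * M + 60 * N + 150) * C.length + 20) := by
  induction C generalizing L with
  | nil =>
    refine .of_wp (body := Expr.extendBody) rfl ?_
    simp [Expr.extendBody, wp, extend]
  | cons r C ih =>
    obtain ⟨hr, hrA⟩ := hC r (by simp)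
    have h1 : (extendItem B it r).1 = worldKey B (extendItem B it r).2.1 := by
      simp [extendItem, worldKey, hk, add_comm]
    have h2 := ih (fun r hr => hC r (by simp [hr])) (hL.insertItem (it := extendItem B it r) h1 hrA)
    have h3 := computes_insertItem (m := m) (extendItem B it r) L
    have h4 := hA L hL
    have h5 := computes_rowKey (m := m) B r
    refine .of_wp (body := Expr.extendBody) rfl ?_
    simp [Expr.extendBody, wp, encItem, Op.apply]
    simp [encItem, extendItem] at h3
    refine ⟨_, _, h5, _, _, h3, _, h2, ?_⟩
    rw [hr]
    nlinarith

theorem computes_extendAll {B N M : ℕ} {A A' : Set (List (List Bool))}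
    (hA' : ∀ L, IsItemList B A' L → L.length ≤ M) {C : List (List Bool)}
    (hC : ∀ S ∈ A, ∀ r ∈ C, r :: S ∈ A') (hN : ∀ r ∈ C, r.length = N)
    {L : List Item} (hL : ∀ it ∈ L, it.1 = worldKey B it.2.1 ∧ it.2.1 ∈ A)
    {L' : List Item} (hL' : IsItemList B A' L') :
    Computes (prog m) 15 (cons (encItems L) (cons (encRows C) (cons (num B) (encItems L'))))
      (encItems (L.foldl (extend B C) L'))
      (((60 * M + 60 * N + 150) * C.length + 100) * L.length + 20) := by
  induction L generalizing L' with
  | nil =>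
    refine .of_wp (body := Expr.extendAllBody) rfl ?_
    simp [Expr.extendAllBody, wp]
  | cons it L ih =>
    obtain ⟨h1, h2⟩ := hL it (by simp)
    have h3 := computes_extend (m := m) hA' it h1 (fun r hr => ⟨hN r hr, hC _ h2 r hr⟩) hL'
    have h4 := ih (fun it hit => hL it (by simp [hit])) (hL'.extend h1 (hC _ h2))
    refine .of_wp (body := Expr.extendAllBody) rfl ?_
    simp [Expr.extendAllBody, wp]
    refine ⟨_, _, h3, _, h4, ?_⟩
    nlinarith

/-- Bound on the number of items. -/
def maxItems (N n : ℕ) : ℕ := n * (n + 1) ^ 2 ^ N + 1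

/-- At most `n` rows contribute at most `(n + 1) ^ 2 ^ N` each to a key. The base is `n + 1` for
every partial table, so one bound serves all stages of the recursion. -/
theorem IsItemList.length_le_maxItems {N n : ℕ} {R : List (List (Option Bool))}
    (hn : R.length ≤ n) (hR : ∀ r ∈ R, r.length = N) {L : List Item}
    (hL : IsItemList (n + 1) {S | S ∈ tableWorlds R} L) : L.length ≤ maxItems N n := by
  refine hL.length_le fun S hS => Nat.lt_succ_of_le ?_
  obtain ⟨h1, h2⟩ := length_of_mem_tableWorlds hR hS
  refine (worldKey_le (Nat.succ_pos n) h2).trans ?_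
  rw [h1]
  gcongr

def itemsTime (N n k : ℕ) : ℕ :=
  (((60 * maxItems N n + 60 * N + 150) * 2 ^ N + 100) * maxItems N n + compTime N + 100) * k + 20

theorem computes_items {N n : ℕ} {R : List (List (Option Bool))} (hn : R.length ≤ n)
    (hR : ∀ r ∈ R, r.length = N) :
    Computes (prog m) 16 (cons (encTable R) (num (n + 1 : ℕ))) (encItems (items (n + 1) R))
      (itemsTime N n R.length) := by
  induction R with
  | nil =>
    refine .of_wp (body := Expr.itemsBody) rfl ?_
    simp [Expr.itemsBody, wp, items, encItem, itemsTime]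
  | cons r R ih =>
    have hr := hR r (by simp)
    have hR' : ∀ r ∈ R, r.length = N := fun r hr => hR r (by simp [hr])
    have hn' : R.length ≤ n := by simp at hn; omega
    have h1 := ih hn' hR'
    have h2 := computes_completions (m := m) r
    have h3 := computes_extendAll (m := m) (B := n + 1) (A := {S | S ∈ tableWorlds R})
      (fun L hL => hL.length_le_maxItems hn hR)
      (fun S hS s hs => cons_mem_tableWorlds hS hs)
      (fun s hs => (length_of_mem_completions hs).trans hr)
      (isItemList_items (n + 1) R).mem (.nil _ _)
    have h4 := (isItemList_items (n + 1) R).length_le_maxItems hn' hR'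
    have h5 := length_completions_le r
    rw [hr] at h2 h5
    refine .of_wp (body := Expr.itemsBody) rfl ?_
    simp [Expr.itemsBody, wp, items]
    simp at h1 h3
    refine ⟨_, _, h1, _, _, h2, _, h3, ?_⟩
    have h6 : ((60 * maxItems N n + 60 * N + 150) * (completions r).length + 100) *
        (items (n + 1) R).length ≤
        ((60 * maxItems N n + 60 * N + 150) * 2 ^ N + 100) * maxItems N n := by gcongr
    simp only [itemsTime]
    nlinarith

theorem computes_length (R : List (List (Option Bool))) :
    Computes (prog m) 17 (encTable R) (num (R.length + 1 : ℕ)) (20 * R.length + 10) := by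
  induction R with
  | nil =>
    refine .of_wp (body := Expr.lengthBody) rfl ?_
    simp [Expr.lengthBody, wp]
  | cons r R ih =>
    refine .of_wp (body := Expr.lengthBody) rfl ?_
    simp [Expr.lengthBody, wp]
    refine ⟨_, _, ih, ?_, ?_⟩
    · simp [Op.apply]
    · omega

theorem computes_blank (R : List (List (Option Bool))) (r : List (Option Bool)) :
    Computes (prog m) 18 (cons (encTable R) (encPartial r))
      (encTable (List.replicate R.length r)) (20 * R.length + 10) := by
  induction R with
  | nil =>
    refine .of_wp (body := Expr.blankBody) rfl ?_
    simp [Expr.blankBody, wp]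
  | cons r R ih =>
    refine .of_wp (body := Expr.blankBody) rfl ?_
    simp [Expr.blankBody, wp, List.replicate_succ]
    exact ⟨_, ih, by omega⟩

/-- A world of maximal weight. -/
noncomputable def bestRows {N : ℕ} (Δ : Network N) :
    List Item → List (List Bool) → ℝ → List (List Bool)
  | [], S, _ => S
  | it :: L, S, w => open Classical in
    if w < weightRows Δ it.2.1 then bestRows Δ L it.2.1 (weightRows Δ it.2.1) else bestRows Δ L S w

theorem bestRows_spec {N : ℕ} (Δ : Network N) (L : List Item) (S : List (List Bool)) (w : ℝ) :
    (bestRows Δ L S w = S ∧ ∀ it ∈ L, weightRows Δ it.2.1 ≤ w) ∨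
    ∃ it ∈ L, bestRows Δ L S w = it.2.1 ∧ w < weightRows Δ it.2.1 ∧
      ∀ it' ∈ L, weightRows Δ it'.2.1 ≤ weightRows Δ it.2.1 := by
  induction L generalizing S w with
  | nil => simp [bestRows]
  | cons it L ih =>
    by_cases hw : w < weightRows Δ it.2.1
    · rw [bestRows, if_pos hw]
      right
      rcases ih it.2.1 (weightRows Δ it.2.1) with ⟨h1, h2⟩ | ⟨it', h0, h1, h2, h3⟩
      · exact ⟨it, by simp, h1, hw, List.forall_mem_cons.2 ⟨le_rfl, h2⟩⟩
      · refine ⟨it', by simp [h0], h1, hw.trans h2, ?_⟩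
        exact List.forall_mem_cons.2 ⟨h2.le, h3⟩
    · rw [bestRows, if_neg hw]
      rcases ih S w with ⟨h1, h2⟩ | ⟨it', h0, h1, h2, h3⟩
      · left
        exact ⟨h1, List.forall_mem_cons.2 ⟨not_lt.1 hw, h2⟩⟩
      · right
        refine ⟨it', by simp [h0], h1, h2, ?_⟩
        exact List.forall_mem_cons.2 ⟨(not_lt.1 hw).trans h2.le, h3⟩

/-! ### Summation and maximization over the items -/

theorem computes_total {N n T : ℕ} {Δ : Network N}
    (hΔ : ∀ S : List (List Bool), S.length = n → Computes (prog m) 9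
      (cons (ofNetwork Δ) (encRows S)) (num (weightRows Δ S)) T)
    {L : List Item} (hL : ∀ it ∈ L, it.2.1.length = n) :
    Computes (prog m) 19 (cons (encItems L) (ofNetwork Δ)) (num (itemSum (weightRows Δ) L))
      ((T + 50) * L.length + 10) := by
  induction L with
  | nil =>
    refine .of_wp (body := Expr.totalBody) rfl ?_
    simp [Expr.totalBody, wp, itemSum]
  | cons it L ih =>
    refine .of_wp (body := Expr.totalBody) rfl ?_
    simp [Expr.totalBody, wp, encItem]
    refine ⟨_, _, hΔ _ (hL it (by simp)), _, _, ih fun it hit => hL it (by simp [hit]), ?_, ?_⟩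
    · simp [itemSum, Op.apply]
    · nlinarith

theorem computes_best {N n T : ℕ} {Δ : Network N}
    (hΔ : ∀ S : List (List Bool), S.length = n → Computes (prog m) 9
      (cons (ofNetwork Δ) (encRows S)) (num (weightRows Δ S)) T)
    {L : List Item} (hL : ∀ it ∈ L, it.2.1.length = n) (S : List (List Bool)) (w : ℝ) :
    Computes (prog m) 20 (cons (encItems L) (cons (ofNetwork Δ) (cons (encRows S) (num w))))
      (encRows (bestRows Δ L S w)) ((T + 60) * L.length + 10) := by
  induction L generalizing S w with
  | nil =>
    refine .of_wp (body := Expr.bestBody) rfl ?_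
    simp [Expr.bestBody, wp, bestRows]
  | cons it L ih =>
    have ih' := ih fun it hit => hL it (by simp [hit])
    refine .of_wp (body := Expr.bestBody) rfl ?_
    simp [Expr.bestBody, wp, encItem]
    refine ⟨_, _, hΔ _ (hL it (by simp)), ?_, ?_⟩
    · intro hw
      rw [toReal_num] at hw
      rw [bestRows, if_pos hw]
      exact ⟨_, ih' _ _, by nlinarith⟩
    · intro hw
      rw [toReal_num] at hw
      rw [bestRows, if_neg (not_lt.2 hw)]
      exact ⟨_, ih' _ _, by nlinarith⟩

end
/-! ### Worlds and tables -/

section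
open Val

def rowOf {N n : ℕ} (x : World N n) (d : Fin n) : List Bool := List.ofFn fun p => x p d

def rowsOf {N n : ℕ} (x : World N n) : List (List Bool) := List.ofFn (rowOf x)

def tableOf {N n : ℕ} (e : Evidence N n) : List (List (Option Bool)) :=
  List.ofFn fun d => List.ofFn fun p => e p d

theorem encTable_tableOf {N n : ℕ} (e : Evidence N n) : encTable (tableOf e) = ofEvidence e := by
  simp only [encTable, tableOf, ofEvidence, List.map_ofFn, Function.comp_def, encPartial]

theorem encRows_rowsOf {N n : ℕ} (x : World N n) : encRows (rowsOf x) = ofWorld x := by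
  simp only [encRows, rowsOf, rowOf, ofWorld, ofEvidence, List.map_ofFn, Function.comp_def, encRow]

theorem rowsOf_injective {N n : ℕ} : Function.Injective (rowsOf : World N n → _) := by
  intro x y h
  funext p d
  exact congrFun (List.ofFn_injective (congrFun (List.ofFn_injective h) d)) p

/-- Atoms see an element only through its row, and a quantifier over elements becomes one over the
list of rows, where repetitions are harmless. An uninstantiated variable corresponds to the empty
row, whose entries default to false. -/
theorem holds_eq_holdsRows {N n : ℕ} (x : World N n) (f : Formula N) (g : ℕ → Option (Fin n)) :
    holds x f g = holdsRows (rowsOf x) f fun v => (g v).elim [] (rowOf x) := by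
  induction f generalizing g with
  | atom p v => cases h : g v <;> simp [holds, holdsRows, h, rowOf]
  | neg f ih => simp [holds, holdsRows, ih]
  | and f₁ f₂ ih₁ ih₂ => simp [holds, holdsRows, ih₁, ih₂]
  | all v f ih =>
    have h (d : Fin n) : (fun u => (Function.update g v (some d) u).elim [] (rowOf x)) =
        Function.update (fun u => (g u).elim [] (rowOf x)) v (rowOf x d) := by
      funext u
      by_cases hu : u = v
      · subst hu; simp
      · simp [hu]
    rw [Bool.eq_iff_iff]
    simp only [holds, holdsRows, ih, h, decide_eq_true_eq, List.all_eq_true, rowsOf,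
      List.forall_mem_ofFn_iff]

/-- Functions on a finite set are determined by the value at one point and the other values. -/
def piEraseEquiv {n : ℕ} (S : Finset ℕ) (v : ℕ) (hv : v ∈ S) :
    (Fin n × ({u // u ∈ S.erase v} → Fin n)) ≃ ({u // u ∈ S} → Fin n) where
  toFun p u := if hu : u.1 = v then p.1 else p.2 ⟨u.1, Finset.mem_erase.2 ⟨hu, u.2⟩⟩
  invFun h := (h ⟨v, hv⟩, fun u => h ⟨u.1, Finset.mem_of_mem_erase u.2⟩)
  left_inv p := by
    ext u
    · simp
    · simp [Finset.ne_of_mem_erase u.2]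
  right_inv h := by
    funext u
    by_cases hu : u.1 = v
    · obtain ⟨u, hu'⟩ := u
      subst hu
      simp
    · simp [hu]

/-- The nested loops are an iterated product: `piEraseEquiv` splits off the value of the first
variable. The map `g` holds the values chosen by the outer loops. -/
theorem prodRows_eq {N n : ℕ} (x : World N n) (w : ℝ) (f : Formula N) {vs : List ℕ}
    (hvs : vs.Nodup) {S : Finset ℕ} (hS : ∀ v, v ∈ S ↔ v ∈ vs) (g : ℕ → Option (Fin n)) :
    prodRows (rowsOf x) w f vs (fun v => (g v).elim [] (rowOf x)) =
      ∏ h : {v // v ∈ S} → Fin n,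
        if holds x f (fun v => if hv : v ∈ S then some (h ⟨v, hv⟩) else g v) = true
        then w else 1 := by
  induction vs generalizing S g with
  | nil =>
    obtain rfl : S = ∅ := Finset.eq_empty_of_forall_notMem fun v hv => by simpa using (hS v).1 hv
    simp [prodRows, holds_eq_holdsRows]
  | cons v vs ih =>
    have hv : v ∈ S := (hS v).2 (by simp)
    obtain ⟨hv', hvs'⟩ := List.nodup_cons.1 hvs
    have hS' : ∀ u, u ∈ S.erase v ↔ u ∈ vs := by
      intro u
      rw [Finset.mem_erase, hS, List.mem_cons]
      by_cases hu : u = v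
      · subst hu; simp [hv']
      · simp [hu]
    have hE (d : Fin n) : Function.update (fun u => (g u).elim [] (rowOf x)) v (rowOf x d) =
        fun u => (Function.update g v (some d) u).elim [] (rowOf x) := by
      funext u
      by_cases hu : u = v
      · subst hu; simp
      · simp [hu]
    rw [prodRows, rowsOf, List.map_ofFn, List.prod_ofFn, ← rowsOf]
    simp only [Function.comp_apply, hE, ih hvs' hS']
    rw [← Fintype.prod_prod_type', ← (piEraseEquiv S v hv).prod_comp]
    refine Fintype.prod_congr _ _ fun p => ?_
    congr 3
    funext u
    by_cases hu : u = v
    · subst hu; simp [hv, piEraseEquiv]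
    · simp [hu, piEraseEquiv]

theorem weight_eq_weightRows {N n : ℕ} (Δ : Network N) (x : World N n) :
    weight Δ x = weightRows Δ (rowsOf x) := by
  rw [weight, weightRows]
  congr 1
  refine List.map_congr_left fun wf _ => ?_
  have h := prodRows_eq x (Real.exp wf.1) wf.2 (nodup_vars wf.2.marks 0) (S := wf.2.freeVars)
    (fun v => by simp [mem_vars, Formula.isCons_nth_marks]) fun _ => none
  simp only [Option.elim_none] at h
  exact h.symm

/-- The world enters only through the range of the quantifiers, where order is irrelevant. -/
theorem holdsRows_perm {N : ℕ} {R S : List (List Bool)} (h : R.Perm S) (f : Formula N)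
    (E : ℕ → List Bool) : holdsRows R f E = holdsRows S f E := by
  induction f generalizing E with
  | atom p v => rfl
  | neg f ih => simp only [holdsRows, ih]
  | and f₁ f₂ ih₁ ih₂ => simp only [holdsRows, ih₁, ih₂]
  | all v f ih => simp only [holdsRows, ih, h.all_eq]

theorem prodRows_perm {N : ℕ} {R S : List (List Bool)} (h : R.Perm S) (w : ℝ) (f : Formula N)
    (vs : List ℕ) (E : ℕ → List Bool) : prodRows R w f vs E = prodRows S w f vs E := by
  induction vs generalizing E with
  | nil => simp only [prodRows, holdsRows_perm h]
  | cons v vs ih =>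
    simp only [prodRows, ih]
    exact (h.map _).prod_eq

theorem weightRows_perm {N : ℕ} (Δ : Network N) {R S : List (List Bool)} (h : R.Perm S) :
    weightRows Δ R = weightRows Δ S := by
  simp only [weightRows, prodRows_perm h]

theorem weight_pos {N n : ℕ} (Δ : Network N) (x : World N n) : 0 < weight Δ x := by
  refine List.prod_pos fun a ha => ?_
  obtain ⟨wf, -, rfl⟩ := List.mem_map.1 ha
  refine Finset.prod_pos fun g _ => ?_
  split
  · exact Real.exp_pos _
  · exact one_pos

/-! ### Worlds that agree with the evidence -/

theorem mem_completions {r : List (Option Bool)} {s : List Bool} :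
    s ∈ completions r ↔ List.Forall₂ (fun b c => ∀ a, b = some a → c = a) r s := by
  induction r generalizing s with
  | nil => simp [completions]
  | cons b r ih =>
    cases s with
    | nil => cases b <;> simp [completions]
    | cons c s => cases b <;> cases c <;> simp [completions, ih, and_comm]

theorem mem_tableWorlds {R : List (List (Option Bool))} {S : List (List Bool)} :
    S ∈ tableWorlds R ↔ List.Forall₂ (fun r s => s ∈ completions r) R S := by
  induction R generalizing S with
  | nil => simp [tableWorlds]
  | cons r R ih =>
    cases S with
    | nil => simp [tableWorlds]
    | cons s S => simp [tableWorlds, ih, and_comm]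

theorem nodup_completions (r : List (Option Bool)) : (completions r).Nodup := by
  induction r with
  | nil => simp [completions]
  | cons b r ih =>
    have h (b : Bool) : ((completions r).map (b :: ·)).Nodup := ih.map List.cons_injective
    cases b with
    | some b => exact h b
    | none =>
      refine List.nodup_append.2 ⟨h _, h _, ?_⟩
      simp

theorem nodup_tableWorlds (R : List (List (Option Bool))) : (tableWorlds R).Nodup := by
  induction R with
  | nil => simp [tableWorlds]
  | cons r R ih =>
    refine List.nodup_flatMap.2 ⟨fun S _ => ?_, ih.imp fun {S S'} h => ?_⟩
    · exact (nodup_completions r).map fun s s' h => (List.cons.inj h).1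
    · rw [Function.onFun, List.disjoint_left]
      intro a ha ha'
      simp only [List.mem_map] at ha ha'
      obtain ⟨s, -, rfl⟩ := ha
      obtain ⟨s', -, h'⟩ := ha'
      exact h (List.cons.inj h').2.symm

theorem length_tableOf {N n : ℕ} (e : Evidence N n) : (tableOf e).length = n := by
  simp [tableOf]

theorem length_of_mem_tableOf {N n : ℕ} (e : Evidence N n) : ∀ r ∈ tableOf e, r.length = N := by
  simp [tableOf, List.mem_ofFn]

theorem rowsOf_mem_tableWorlds {N n : ℕ} {e : Evidence N n} {x : World N n} :
    rowsOf x ∈ tableWorlds (tableOf e) ↔ Agrees x e := by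
  simp only [mem_tableWorlds, mem_completions, List.forall₂_iff_get, rowsOf, rowOf, tableOf,
    Agrees, List.length_ofFn, List.get_eq_getElem, List.getElem_ofFn, true_and]
  constructor
  · intro h p d b hb
    exact h d d.2 d.2 p p.2 p.2 b hb
  · intro h d hd _ p hp _ b hb
    exact h ⟨p, hp⟩ ⟨d, hd⟩ b hb

theorem exists_rowsOf_eq {N n : ℕ} {S : List (List Bool)} (hS : S.length = n)
    (hS' : ∀ s ∈ S, s.length = N) : ∃ x : World N n, rowsOf x = S := by
  subst hS
  have hl (d : Fin S.length) : S[d].length = N := hS' _ (List.getElem_mem _)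
  refine ⟨fun p d => S[d][p]'(by rw [hl]; exact p.2), ?_⟩
  refine List.ext_getElem (by simp [rowsOf]) fun d hd hd' => ?_
  refine List.ext_getElem (by simp [rowsOf, rowOf, hS' _ (List.getElem_mem _)]) fun p hp hp' => ?_
  simp [rowsOf, rowOf]

theorem exists_rowsOf_eq_of_mem {N n : ℕ} {e : Evidence N n} {S : List (List Bool)}
    (hS : S ∈ tableWorlds (tableOf e)) : ∃ x : World N n, Agrees x e ∧ rowsOf x = S := by
  obtain ⟨h1, h2⟩ := length_of_mem_tableWorlds (length_of_mem_tableOf e) hS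
  obtain ⟨x, rfl⟩ := exists_rowsOf_eq (h1.trans (length_tableOf e)) h2
  exact ⟨x, rowsOf_mem_tableWorlds.1 hS, rfl⟩

open Classical in
theorem sum_tableWorlds {N n : ℕ} (e : Evidence N n) (F : List (List Bool) → ℝ) :
    ((tableWorlds (tableOf e)).map F).sum = ∑ x : World N n with Agrees x e, F (rowsOf x) := by
  rw [← List.sum_toFinset F (nodup_tableWorlds _)]
  symm
  refine Finset.sum_nbij rowsOf (fun x hx => ?_) (rowsOf_injective.injOn) (fun S hS => ?_)
    fun _ _ => rfl
  · simpa [rowsOf_mem_tableWorlds] using hx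
  · obtain ⟨x, hx, rfl⟩ := exists_rowsOf_eq_of_mem (by simpa using hS)
    exact ⟨x, by simpa using hx, rfl⟩

open Classical in
theorem itemSum_items_tableOf {N n : ℕ} (Δ : Network N) (e : Evidence N n) :
    itemSum (weightRows Δ) (items (n + 1) (tableOf e)) =
      ∑ x : World N n with Agrees x e, weight Δ x := by
  rw [itemSum_items (by simp [length_tableOf]) (length_of_mem_tableOf e)
    fun _ _ h => weightRows_perm Δ h, sum_tableWorlds]
  simp only [weight_eq_weightRows]

/-- Every world agrees with blank evidence, so the same procedure computes `Z`. -/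
theorem marginal_eq {N n : ℕ} (Δ : Network N) (e : Evidence N n) :
    marginal Δ e = itemSum (weightRows Δ) (items (n + 1) (tableOf e)) /
      itemSum (weightRows Δ) (items (n + 1) (tableOf fun (_ : Fin N) (_ : Fin n) => none)) := by
  classical
  rw [itemSum_items_tableOf, itemSum_items_tableOf, marginal, Finset.sum_div]
  have h (x : World N n) : Agrees x fun _ _ => none := fun _ _ _ h => by simp at h
  simp only [h, Finset.filter_true, prob, partitionFunction]

theorem partitionFunction_pos {N : ℕ} (Δ : Network N) (n : ℕ) : 0 < partitionFunction Δ n :=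
  Finset.sum_pos (fun x _ => weight_pos Δ x) ⟨fun _ _ => false, Finset.mem_univ _⟩

/-- Weights are positive and every class of agreeing worlds has an item, so the initial pair of `[]`
and 0 is always replaced. -/
theorem isMPE_bestRows {N n : ℕ} (Δ : Network N) (e : Evidence N n) :
    ∃ x : World N n, IsMPE Δ e x ∧ rowsOf x = bestRows Δ (items (n + 1) (tableOf e)) [] 0 := by
  have hB : (tableOf e).length < n + 1 := by simp [length_tableOf]
  have hperm {x : World N n} (hx : Agrees x e) :
      ∃ it ∈ items (n + 1) (tableOf e), weightRows Δ it.2.1 = weight Δ x := by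
    obtain ⟨it, hit, h⟩ := exists_mem_items_perm hB (length_of_mem_tableOf e)
      (rowsOf_mem_tableWorlds.2 hx)
    exact ⟨it, hit, by rw [weightRows_perm Δ h, weight_eq_weightRows]⟩
  rcases bestRows_spec Δ (items (n + 1) (tableOf e)) [] 0 with ⟨-, h⟩ | ⟨it, hit, h1, -, h2⟩
  -- Setting all open atoms to false gives an agreeing world, so the list of items is not empty.
  · have h0 : Agrees (fun p d => (e p d).getD false) e := fun p d b h => by simp [h]
    obtain ⟨it, hit, h1⟩ := hperm h0
    exact absurd (h it hit) (not_le.2 (h1 ▸ weight_pos Δ _))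
  · obtain ⟨x, hx, hxS⟩ := exists_rowsOf_eq_of_mem ((isItemList_items _ _).mem it hit).2
    refine ⟨x, ⟨hx, fun x' hx' => ?_⟩, hxS.trans h1.symm⟩
    obtain ⟨it', hit', h3⟩ := hperm hx'
    have h4 := h2 it' hit'
    rw [h3, ← hxS, ← weight_eq_weightRows] at h4
    exact div_le_div_of_nonneg_right h4 (partitionFunction_pos Δ n).le

/-! ### Running time -/

theorem isPoly_maxItems (N : ℕ) : IsPoly (maxItems N) :=
  (IsPoly.id.mul ((IsPoly.id.add (.const 1)).pow _)).add (.const 1)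

theorem isPoly_itemsTime (N : ℕ) : IsPoly fun n => itemsTime N n n := by
  have h := isPoly_maxItems N
  exact (((((((((IsPoly.const 60).mul h).add (.const (60 * N))).add (.const 150)).mul
    (.const (2 ^ N))).add (.const 100)).mul h).add (.const (compTime N))).add
    (.const 100)).mul .id |>.add (.const 20)

theorem length_of_mem_items {N n : ℕ} {e : Evidence N n} {it : Item}
    (h : it ∈ items (n + 1) (tableOf e)) : it.2.1.length = n :=
  (length_of_mem_tableWorlds (length_of_mem_tableOf e)
    ((isItemList_items _ _).mem it h).2).1.trans (length_tableOf e)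

theorem length_items_le {N n : ℕ} (e : Evidence N n) :
    (items (n + 1) (tableOf e)).length ≤ maxItems N n :=
  (isItemList_items _ _).length_le_maxItems (length_tableOf e).le (length_of_mem_tableOf e)

variable {m : Expr}

theorem computes_items_tableOf {N n : ℕ} (e : Evidence N n) :
    Computes (prog m) 16 (cons (ofEvidence e) (num (n + 1 : ℕ)))
      (encItems (items (n + 1) (tableOf e))) (itemsTime N n n) := by
  have h := computes_items (m := m) (length_tableOf e).le (length_of_mem_tableOf e)
  rwa [encTable_tableOf, length_tableOf] at h

theorem computes_length_tableOf {N n : ℕ} (e : Evidence N n) :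
    Computes (prog m) 17 (ofEvidence e) (num (n + 1 : ℕ)) (20 * n + 10) := by
  have h := computes_length (m := m) (tableOf e)
  rwa [encTable_tableOf, length_tableOf] at h

/-- The unary numeral `N` is a list of `N` copies of `nil`, and `nil` encodes an unassigned entry;
so the input `N` doubles as a blank row. -/
theorem computes_blank_tableOf {N n : ℕ} (e : Evidence N n) :
    Computes (prog m) 18 (cons (ofEvidence e) (ofNat N))
      (ofEvidence fun (_ : Fin N) (_ : Fin n) => none) (20 * n + 10) := by
  have h := computes_blank (m := m) (tableOf e) (List.replicate N none)
  rw [encTable_tableOf, length_tableOf] at h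
  simpa [encPartial, ← encTable_tableOf, tableOf, ofNat, ofOptionBool, List.ofFn_const] using h

/-! ### The two algorithms -/

theorem domainLifted_mpe : DomainLifted MPETask := by
  refine ⟨prog Expr.mpeBody, fun N Δ => ?_⟩
  obtain ⟨T, hT, hΔ⟩ := computes_weight (m := Expr.mpeBody) Δ
  have hpoly : IsPoly fun n =>
      20 * n + itemsTime N n n + (T n + 60) * maxItems N n + 100 :=
    ((((IsPoly.const 20).mul .id).add (isPoly_itemsTime N)).add
      ((hT.add (.const 60)).mul (isPoly_maxItems N))).add (.const 100)
  obtain ⟨q, hq⟩ := hpoly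
  refine ⟨q, fun n e => ?_⟩
  have hqn := hq n
  beta_reduce at hqn
  obtain ⟨x, hx, hxS⟩ := isMPE_bestRows Δ e
  have h1 := computes_best (m := Expr.mpeBody) (n := n) (T := T n) (fun S hS => hS ▸ hΔ S)
    (fun it hit => length_of_mem_items (e := e) hit) [] 0
  -- The program constant 0 evaluates to the cast of a natural number, and the starting weight is
  -- put in that form.
  rw [← hxS, encRows_rowsOf, ← Nat.cast_zero (R := ℝ)] at h1
  -- The two steps set aside are those of the initial call and its argument, added by
  -- `Computes.runs`.
  have h2 : Computes (prog Expr.mpeBody) 0 (ofInstance Δ e) (ofWorld x) (q.eval n - 2) := by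
    refine .of_wp (body := Expr.mpeBody) rfl ?_
    have h3 := computes_items_tableOf (m := Expr.mpeBody) e
    have h4 := computes_length_tableOf (m := Expr.mpeBody) e
    have h5 : (T n + 60) * (items (n + 1) (tableOf e)).length ≤ (T n + 60) * maxItems N n := by
      gcongr
      exact length_items_le e
    simp only [Expr.mpeBody, wp, ofInstance, List.getElem?_cons_zero, head_cons, tail_cons]
    refine ⟨_, _, h4, _, _, h3, _, _, h1, rfl, ?_⟩
    omega
  obtain ⟨t, ht, hle⟩ := h2.runs
  refine ⟨_, t, ht, hle.trans ?_, x, hx, rfl⟩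
  omega

theorem domainLifted_marginal : DomainLifted MarginalTask := by
  refine ⟨prog Expr.marginalBody, fun N Δ => ?_⟩
  obtain ⟨T, hT, hΔ⟩ := computes_weight (m := Expr.marginalBody) Δ
  have hpoly : IsPoly fun n =>
      40 * n + 2 * itemsTime N n n + 2 * ((T n + 50) * maxItems N n) + 200 :=
    ((((IsPoly.const 40).mul .id).add ((IsPoly.const 2).mul (isPoly_itemsTime N))).add
      ((IsPoly.const 2).mul ((hT.add (.const 50)).mul (isPoly_maxItems N)))).add (.const 200)
  obtain ⟨q, hq⟩ := hpoly
  refine ⟨q, fun n e => ?_⟩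
  have hqn := hq n
  beta_reduce at hqn
  -- The evidence is kept general, since the bounds are needed both for `e` and for the blank table.
  have htotal (e : Evidence N n) := computes_total (m := Expr.marginalBody) (n := n) (T := T n)
    (fun S hS => hS ▸ hΔ S) (fun it hit => length_of_mem_items (e := e) hit)
  have hlen (e : Evidence N n) :
      (T n + 50) * (items (n + 1) (tableOf e)).length ≤ (T n + 50) * maxItems N n := by
    gcongr
    exact length_items_le e
  have h2 : Computes (prog Expr.marginalBody) 0 (ofInstance Δ e) (num (marginal Δ e))
      (q.eval n - 2) := by
    refine .of_wp (body := Expr.marginalBody) rfl ?_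
    simp only [Expr.marginalBody, wp, ofInstance, List.getElem?_cons_zero,
      List.getElem?_cons_succ, head_cons, tail_cons]
    refine ⟨_, _, computes_length_tableOf e, _, _, computes_items_tableOf e, _, _, htotal e, _, _,
      computes_blank_tableOf e, _, _, computes_items_tableOf _, _, _, htotal _, ?_, ?_⟩
    · rw [marginal_eq]
      rfl
    · have h3 := hlen e
      have h4 := hlen fun _ _ => none
      omega
  obtain ⟨t, ht, hle⟩ := h2.runs
  refine ⟨_, t, ht, hle.trans ?_, rfl⟩
  omega

end
end MLN

theorem mainTheorem8 : MLN.DomainLifted MLN.MPETask ∧ MLN.DomainLifted MLN.MarginalTask :=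
  ⟨MLN.domainLifted_mpe, MLN.domainLifted_marginal⟩
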